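/- Let $p$ be a prime and let $\mathsf{k}$ be an $F$-finite field of characteristic $p$. Then every locally acyclic cluster algebra $\mathcal{A}$ over $\mathsf{k}$ is strongly $F$-regular. The terms are as follows. A commutative ring $R$ of characteristic $p$ is $F$-finite if $R^{1/p}$ is a finitely generated $R$-module. Here $R^{1/p^e}$ is a copy of the ring $R$ with elements written $r^{1/p^e}$, on which $R$ acts by $r\cdot x^{1/p^e}=(r^{p^e}x)^{1/p^e}$. An $F$-finite domain $R$ is strongly $F$-regular if for every nonzero $x\in R$ there are $e\in\mathbb{N}$ and $\psi\in\operatorname{Hom}_R(R^{1/p^e},R)$ with $\psi(x^{1/p^e})=1$. Let $\mathcal{F}$ be a field extension of $\mathsf{k}$. A seed $(\mathsf{Q},\mathbf{x})$ for $\mathcal{F}$ over $\mathsf{k}$ is a finite quiver $\mathsf{Q}$ without loops or directed 2-cycles on a vertex set $\{1,\dots,n\}$, a tuple $\mathbf{x}=(x_1,\dots,x_n)$ (a cluster) of algebraically independent generators of the field $\mathcal{F}$ over $\mathsf{k}$, and a set of vertices designated as frozen, the others being mutable; every vertex that touches no arrow is required to be frozen. Mutation at a mutable vertex $j$ replaces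 $x_j$ by $x_j'=\bigl(\prod_{i\to j}x_i+\prod_{j\to i}x_i\bigr)x_j^{-1}$ (products over arrows), keeps the other variables and the frozen set, and changes $\mathsf{Q}$ by adding an arrow $i\to l$ for each pair of arrows $i\to j\to l$, then reversing all arrows incident to $j$, then cancelling directed 2-cycles in pairs. Seeds related by a sequence of mutations are mutation-equivalent. The cluster algebra $\mathcal{A}(\mathsf{Q},\mathbf{x})$ is the $\mathsf{k}$-subalgebra of $\mathcal{F}$ generated by the elements of all clusters of seeds mutation-equivalent to $(\mathsf{Q},\mathbf{x})$ and the inverses of the frozen variables; these seeds are its seeds. A seed is acyclic if its quiver has no directed cycle all of whose vertices are mutable, and a cluster algebra is acyclic if it has an acyclic seed. A cluster localization of $\mathcal{A}$ is a cluster algebra $\mathcal{A}(\mathsf{Q}^\dagger,\mathbf{x}^\dagger)$ obtained from a seed $(\mathsf{Q},\mathbf{x})$ of $\mathcal{A}$ by making some (possibly no) mutable vertices $k_1,\dots,k_a$ frozen, provided that $\mathcal{A}(\mathsf{Q}^\dagger,\mathbf{x}^\dagger)=\mathcal{A}[x_{k_1}^{-1},\dots,x_{k_a}^{-1}]$. The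 cluster algebra $\mathcal{A}$ is locally acyclic if there is a set $\{\mathcal{A}_i\}_{i\in I}$ of cluster localizations of $\mathcal{A}$, each an acyclic cluster algebra, whose open subschemes cover it: $\operatorname{Spec}(\mathcal{A})=\bigcup_{i\in I}\operatorname{Spec}(\mathcal{A}_i)$. -/

import Mathlib

namespace ClusterAlg

/-! ## Quivers and quiver mutation -/

/-- A quiver without loops or directed 2-cycles on the vertex set `ι`, recorded by the number
`arrows i j` of arrows `i → j`. -/
@[ext]
structure ClusterQuiver (ι : Type*) where
  arrows : ι → ι → ℕ
  no_loop : ∀ i, arrows i i = 0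
  no_two_cycle : ∀ i j, arrows i j = 0 ∨ arrows j i = 0

namespace ClusterQuiver

variable {ι : Type*}

/-- The vertex `i` touches at least one arrow. -/
def Touches (Q : ClusterQuiver ι) (i : ι) : Prop :=
  ∃ j, 0 < Q.arrows i j ∨ 0 < Q.arrows j i

/-- Mutation, step 1: for each pair of arrows `i → k → j`, add an arrow `i → j`. -/
def addPaths (a : ι → ι → ℕ) (k : ι) : ι → ι → ℕ :=
  fun i j => a i j + a i k * a k j

/-- Mutation, step 2: reverse every arrow incident to `k`. -/
def reverseAt [DecidableEq ι] (a : ι → ι → ℕ) (k : ι) : ι → ι → ℕ :=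
  fun i j => if i = k ∨ j = k then a j i else a i j

/-- Mutation, step 3: cancel directed 2-cycles in pairs. The subtraction is the truncated one:
of `a i j` arrows `i → j` and `a j i` arrows `j → i`, exactly `a i j - a j i` arrows `i → j`
survive if `a i j ≥ a j i`, and none otherwise. -/
def cancel (a : ι → ι → ℕ) : ι → ι → ℕ :=
  fun i j => a i j - a j i

/-- The mutation `μ_k(Q)`. -/
def mutate [DecidableEq ι] (Q : ClusterQuiver ι) (k : ι) : ClusterQuiver ι where
  arrows := cancel (reverseAt (addPaths Q.arrows k) k)
  no_loop i := by simp [cancel]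
  no_two_cycle i j := by simp only [cancel]; omega

theorem touches_mutate [DecidableEq ι] (Q : ClusterQuiver ι) (k i : ι) (h : Q.Touches i) :
    (Q.mutate k).Touches i := by
  obtain ⟨j, hj⟩ := h
  have hkk := Q.no_loop k
  by_cases hik : i = k
  · subst hik
    refine ⟨j, ?_⟩
    have := Q.no_two_cycle i j
    simp only [mutate, cancel, reverseAt, addPaths, hkk]
    simp
    omega
  · by_cases h0 : Q.arrows i k = 0 ∧ Q.arrows k i = 0
    · refine ⟨j, ?_⟩
      have := Q.no_two_cycle i j
      have hjk : j ≠ k := by rintro rfl; omega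
      simp only [mutate, cancel, reverseAt, addPaths, h0.1, h0.2]
      simp [hik, hjk]
      omega
    · refine ⟨k, ?_⟩
      have := Q.no_two_cycle i k
      simp only [mutate, cancel, reverseAt, addPaths, hkk]
      simp
      omega

end ClusterQuiver

/-! ## Seeds and seed mutation -/

/-- A seed for the field `F` over `k`, with vertices indexed by the finite set `ι`: a quiver, a
bijection `x` from the vertices to a set of algebraically independent generators of the field `F`
over `k`, and a set of frozen vertices. By convention a vertex that touches no arrow is frozen. -/
structure Seed (k F ι : Type*) [Field k] [Field F] [Algebra k F] where
  quiver : ClusterQuiver ι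
  x : ι → F
  frozen : Set ι
  algebraicIndependent : AlgebraicIndependent k x
  adjoin_eq_top : IntermediateField.adjoin k (Set.range x) = ⊤
  touches : ∀ i, i ∉ frozen → quiver.Touches i

namespace Seed

variable {k F ι : Type*} [Field k] [Field F] [Algebra k F]

/-- The numerator `∏_{i → j} x i + ∏_{j → i} x i` of the mutation formula at `j`
(products over arrows, that is, with multiplicity). -/
def exchangePoly [Fintype ι] (s : Seed k F ι) (j : ι) : F :=
  ∏ i, s.x i ^ s.quiver.arrows i j + ∏ i, s.x i ^ s.quiver.arrows j i

/-- The mutated cluster `μ_j(x)`: the variable at `j` is replaced by the quotient of the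
numerator by `x j`. -/
def mutateCluster [Fintype ι] [DecidableEq ι] (s : Seed k F ι) (j : ι) : ι → F :=
  Function.update s.x j (s.exchangePoly j * (s.x j)⁻¹)

theorem x_ne_zero (s : Seed k F ι) (i : ι) : s.x i ≠ 0 :=
  s.algebraicIndependent.ne_zero i

theorem exchangePoly_ne_zero [Fintype ι] (s : Seed k F ι) {j : ι} (hj : j ∉ s.frozen) :
    s.exchangePoly j ≠ 0 := by
  classical
  set f : ι →₀ ℕ := Finsupp.equivFunOnFinite.symm (fun i => s.quiver.arrows i j) with hf
  set g : ι →₀ ℕ := Finsupp.equivFunOnFinite.symm (fun i => s.quiver.arrows j i) with hg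
  have hfg : f ≠ g := by
    intro h
    obtain ⟨i, hi⟩ := s.touches j hj
    have h1 : s.quiver.arrows i j = s.quiver.arrows j i := by
      simpa [hf, hg] using DFunLike.congr_fun h i
    have h2 := s.quiver.no_two_cycle i j
    omega
  have hP : (MvPolynomial.monomial f (1 : k) + MvPolynomial.monomial g 1) ≠ 0 := by
    intro h
    have := congrArg (MvPolynomial.coeff f) h
    simp [MvPolynomial.coeff_monomial, hfg.symm] at this
  have key : MvPolynomial.aeval s.x (MvPolynomial.monomial f (1 : k) + MvPolynomial.monomial g 1)
      = s.exchangePoly j := by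
    rw [map_add, MvPolynomial.aeval_monomial, MvPolynomial.aeval_monomial,
      Finsupp.prod_fintype _ _ (by simp), Finsupp.prod_fintype _ _ (by simp)]
    simp [exchangePoly, hf, hg]
  rw [← key]
  intro h
  exact hP ((map_eq_zero_iff _ s.algebraicIndependent).1 h)

theorem adjoin_mutateCluster [Fintype ι] [DecidableEq ι] (s : Seed k F ι) {j : ι}
    (hj : j ∉ s.frozen) :
    IntermediateField.adjoin k (Set.range (s.mutateCluster j)) = ⊤ := by
  set K := IntermediateField.adjoin k (Set.range (s.mutateCluster j)) with hK
  have hmem : ∀ i, s.mutateCluster j i ∈ K := fun i =>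
    IntermediateField.subset_adjoin k _ ⟨i, rfl⟩
  have hne : ∀ i, i ≠ j → s.x i ∈ K := fun i hi => by
    simpa [mutateCluster, hi] using hmem i
  have hP : s.exchangePoly j ∈ K := by
    refine add_mem (prod_mem fun i _ => ?_) (prod_mem fun i _ => ?_)
    · by_cases h : i = j
      · subst h; simp [s.quiver.no_loop]
      · exact pow_mem (hne i h) _
    · by_cases h : i = j
      · subst h; simp [s.quiver.no_loop]
      · exact pow_mem (hne i h) _
  have hxj : s.x j ∈ K := by
    have h1 := hmem j
    simp only [mutateCluster, Function.update_self] at h1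
    have h2 := mul_mem hP (inv_mem h1)
    have h3 := s.exchangePoly_ne_zero hj
    have h4 := s.x_ne_zero j
    have : s.exchangePoly j * (s.exchangePoly j * (s.x j)⁻¹)⁻¹ = s.x j := by
      field_simp
    rwa [this] at h2
  rw [eq_top_iff, ← s.adjoin_eq_top, IntermediateField.adjoin_le_iff]
  rintro _ ⟨i, rfl⟩
  by_cases h : i = j
  · subst h; exact hxj
  · exact hne i h

theorem algebraicIndependent_mutateCluster [Fintype ι] [DecidableEq ι] (s : Seed k F ι) {j : ι}
    (hj : j ∉ s.frozen) : AlgebraicIndependent k (s.mutateCluster j) := by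
  have isAlg : ∀ y : ι → F, IntermediateField.adjoin k (Set.range y) = ⊤ →
      Algebra.IsAlgebraic (Algebra.adjoin k (Set.range y)) F := by
    intro y hy
    refine ⟨fun z => ?_⟩
    have hz : z ∈ IntermediateField.adjoin k (Set.range y) := hy ▸ IntermediateField.mem_top
    obtain ⟨a, ha, b, hb, rfl⟩ := IntermediateField.mem_adjoin_iff_div.1 hz
    rw [div_eq_mul_inv]
    exact (isAlgebraic_algebraMap (⟨a, ha⟩ : Algebra.adjoin k (Set.range y))).mul
      (isAlgebraic_algebraMap (⟨b, hb⟩ : Algebra.adjoin k (Set.range y))).inv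
  have h1 := isAlg _ s.adjoin_eq_top
  have h2 := isAlg _ (s.adjoin_mutateCluster hj)
  have hb : IsTranscendenceBasis k s.x :=
    s.algebraicIndependent.isTranscendenceBasis_iff_isAlgebraic.2 h1
  exact (Algebra.IsAlgebraic.isTranscendenceBasis_of_lift_le_trdeg_of_finite k (s.mutateCluster j)
    hb.lift_cardinalMk_eq_trdeg.le).1

/-- The mutation of a seed at a mutable vertex `j`. Frozen vertices stay frozen. -/
def mutate [Fintype ι] [DecidableEq ι] (s : Seed k F ι) (j : ι) (hj : j ∉ s.frozen) :
    Seed k F ι where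
  quiver := s.quiver.mutate j
  x := s.mutateCluster j
  frozen := s.frozen
  algebraicIndependent := s.algebraicIndependent_mutateCluster hj
  adjoin_eq_top := s.adjoin_mutateCluster hj
  touches i hi := s.quiver.touches_mutate j i (s.touches i hi)

/-- `t` is obtained from `s` by a finite sequence of mutations at mutable vertices. -/
def MutationEquiv [Fintype ι] [DecidableEq ι] (s t : Seed k F ι) : Prop :=
  Relation.ReflTransGen
    (fun a b : Seed k F ι => ∃ (j : ι) (hj : j ∉ a.frozen), b = a.mutate j hj) s t

/-! ## Cluster algebras, acyclicity, cluster localizations and covers -/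

/-- The set of all cluster variables: the union of the clusters of all mutation-equivalent
seeds. -/
def clusterVariables [Fintype ι] [DecidableEq ι] (s : Seed k F ι) : Set F :=
  {y | ∃ t, s.MutationEquiv t ∧ y ∈ Set.range t.x}

/-- The cluster algebra: the `k`-subalgebra of `F` generated by all cluster variables and the
inverses of the frozen variables. -/
def clusterAlgebra [Fintype ι] [DecidableEq ι] (s : Seed k F ι) : Subalgebra k F :=
  Algebra.adjoin k (s.clusterVariables ∪ {y | ∃ i ∈ s.frozen, y = (s.x i)⁻¹})

/-- The quiver of the seed has no directed cycle through mutable vertices. -/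
def IsAcyclicSeed (s : Seed k F ι) : Prop :=
  ∀ i, ¬ Relation.TransGen
    (fun a b => a ∉ s.frozen ∧ b ∉ s.frozen ∧ 0 < s.quiver.arrows a b) i i

/-- The cluster algebra determined by `s` is acyclic: it admits some acyclic seed. -/
def IsAcyclic [Fintype ι] [DecidableEq ι] (s : Seed k F ι) : Prop :=
  ∃ t, s.MutationEquiv t ∧ t.IsAcyclicSeed

/-- The seed obtained by making the vertices in `S` frozen. -/
def freeze (s : Seed k F ι) (S : Set ι) : Seed k F ι where
  quiver := s.quiver
  x := s.x
  frozen := s.frozen ∪ S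
  algebraicIndependent := s.algebraicIndependent
  adjoin_eq_top := s.adjoin_eq_top
  touches i hi := s.touches i fun h => hi (Or.inl h)

/-- A cluster localization of the cluster algebra `𝒜` of `s`: a seed of `𝒜` and a set of its
mutable vertices such that the cluster algebra of the seed with these vertices frozen equals
the localization of `𝒜` (inside `F`) at the corresponding cluster variables. -/
structure ClusterLocalization [Fintype ι] [DecidableEq ι] (s : Seed k F ι) where
  seed : Seed k F ι
  mutationEquiv : s.MutationEquiv seed
  vertices : Set ι
  mutable : ∀ i ∈ vertices, i ∉ seed.frozen
  clusterAlgebra_freeze : (seed.freeze vertices).clusterAlgebra =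
    Algebra.adjoin k ((s.clusterAlgebra : Set F) ∪ {y | ∃ i ∈ vertices, y = (seed.x i)⁻¹})

/-- The seed with the designated vertices frozen, which determines the cluster localization as
a cluster algebra. -/
def ClusterLocalization.frozenSeed [Fintype ι] [DecidableEq ι] {s : Seed k F ι}
    (c : s.ClusterLocalization) : Seed k F ι :=
  c.seed.freeze c.vertices

theorem ClusterLocalization.le [Fintype ι] [DecidableEq ι] {s : Seed k F ι}
    (c : s.ClusterLocalization) : s.clusterAlgebra ≤ c.frozenSeed.clusterAlgebra := by
  intro y hy
  rw [ClusterLocalization.frozenSeed, c.clusterAlgebra_freeze]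
  exact Algebra.subset_adjoin (Or.inl hy)

/-- The map `Spec 𝒜ᵢ → Spec 𝒜` of a cluster localization `𝒜ᵢ` of `𝒜`, induced by the
inclusion `𝒜 ⊆ 𝒜ᵢ` (it is an open immersion, since `𝒜ᵢ` is a localization of `𝒜` at finitely
many elements). -/
def ClusterLocalization.specMap [Fintype ι] [DecidableEq ι] {s : Seed k F ι}
    (c : s.ClusterLocalization) :
    PrimeSpectrum c.frozenSeed.clusterAlgebra → PrimeSpectrum s.clusterAlgebra :=
  PrimeSpectrum.comap (Subalgebra.inclusion c.le).toRingHom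

/-- A set of cluster localizations is a cluster cover if the open subschemes `Spec 𝒜ᵢ`
cover `Spec 𝒜`. -/
def IsClusterCover [Fintype ι] [DecidableEq ι] (s : Seed k F ι)
    (C : Set s.ClusterLocalization) : Prop :=
  (⋃ c ∈ C, Set.range c.specMap) = Set.univ

/-- The cluster algebra of `s` is locally acyclic: it admits a cluster cover by acyclic cluster
algebras. -/
def IsLocallyAcyclic [Fintype ι] [DecidableEq ι] (s : Seed k F ι) : Prop :=
  ∃ C : Set s.ClusterLocalization, s.IsClusterCover C ∧ ∀ c ∈ C, c.frozenSeed.IsAcyclic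

instance charP_clusterAlgebra [Fintype ι] [DecidableEq ι] (s : Seed k F ι) (p : ℕ) [CharP k p] :
    CharP s.clusterAlgebra p :=
  charP_of_injective_algebraMap (algebraMap k s.clusterAlgebra).injective p

end Seed

/-! ## Strong F-regularity -/

section Frobenius

variable (p : ℕ) (R : Type*) [CommRing R]

/-- The ring `R^{1/p^e}`: a copy of `R`, whose element `FrobRoot.root p R e r` stands for
`r^{1/p^e}`. -/
def FrobRoot (_p : ℕ) (R : Type*) (_e : ℕ) : Type _ := R

instance FrobRoot.instCommRing (e : ℕ) : CommRing (FrobRoot p R e) := inferInstanceAs (CommRing R)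

/-- The canonical ring isomorphism `r ↦ r^{1/p^e}` from `R` to `R^{1/p^e}`. -/
def FrobRoot.root (e : ℕ) : R ≃+* FrobRoot p R e := RingEquiv.refl R

/-- `R^{1/p^e}` as an `R`-algebra through the `e`-th iterate of Frobenius
`r ↦ (r^{p^e})^{1/p^e}`; thus `r • x^{1/p^e} = (r^{p^e} x)^{1/p^e}`. -/
instance FrobRoot.instAlgebra [Fact p.Prime] [CharP R p] (e : ℕ) :
    Algebra R (FrobRoot p R e) :=
  ((FrobRoot.root p R e : R →+* FrobRoot p R e).comp (iterateFrobenius R p e)).toAlgebra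

theorem FrobRoot.smul_root [Fact p.Prime] [CharP R p] (e : ℕ) (r x : R) :
    r • FrobRoot.root p R e x = FrobRoot.root p R e (r ^ p ^ e * x) := rfl

/-- `R` is F-finite: `R^{1/p}` is a finitely generated `R`-module. -/
def IsFFinite [Fact p.Prime] [CharP R p] : Prop :=
  Module.Finite R (FrobRoot p R 1)

/-- `R` is a strongly F-regular ring: an F-finite domain such that for every nonzero `x` there
are `e` and an `R`-linear map `ψ : R^{1/p^e} → R` with `ψ (x^{1/p^e}) = 1`. -/
structure IsStronglyFRegular [Fact p.Prime] [CharP R p] : Prop where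
  isDomain : IsDomain R
  isFFinite : IsFFinite p R
  exists_map : ∀ x : R, x ≠ 0 →
    ∃ (e : ℕ) (ψ : FrobRoot p R e →ₗ[R] R), ψ (FrobRoot.root p R e x) = 1

end Frobenius

end ClusterAlg

/-! Strong `F`-regularity is local on the spectrum, and freezing suitable variables covers a locally
acyclic cluster algebra by rings simple enough to be treated by hand. For fixed `x`, the values at
`x` of the `p ^ e`-inverse linear maps form an ideal. If `c` generates one member of a cover,
`F`-finiteness bounds denominators, so a map on the localization that sends `x` to `1` puts a power
of `c` into this ideal. A Frobenius splitting makes the ideals increase with `e`, so one exponent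
serves a finite cover, and the ideal is the whole ring (`HasPowInvMaps.of_localizations`;
`IsFFinite.of_localizations` is the analogue for `F`-finiteness). This reduces the theorem to
acyclic cluster algebras.

For an acyclic seed the cluster algebra equals the lower bound, generated by the cluster, its
one-step mutations and the inverses of frozen variables (`IsAcyclicSeed.clusterAlgebra_eq_lower`).
The cluster algebra lies in the intersection of the Laurent rings of all its seeds. This is the
Laurent phenomenon: upper bounds do not change under mutation when the exchange matrix has full
rank, and principal coefficients, later specialized to `1`, supply the full rank. Conversely, this
intersection lies in the lower bound. When no arrow joins two mutable vertices, this is a repeated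
intersection of two Laurent rings in one variable. In general, a mutable source `i` with a mutable
arrow `i → j` makes `x i` and `x j` comaximal, so freezing `i` and freezing `j` give a cover with
fewer mutable vertices (`IsAcyclicSeed.induction`).

The same induction proves strong `F`-regularity of lower bounds from the case without mutable arrows
(`IsIsolated.hasPowInvMaps`). There the standard trace of the Laurent ring, which keeps the
monomials with exponents divisible by `q = p ^ e`, preserves the lower bound. A nonzero element can
be multiplied within the lower bound to have constant coefficient `1`, and for large `q` the trace
kills all its other terms. -/

namespace ClusterAlg

/-! ### Inverse linear maps and `F`-finiteness. -/

section FRegular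

variable {p : ℕ} {R : Type*} [CommRing R]

/-- Additive maps `f : R → R` with `f (r ^ q * x) = r * f x`; for `q = p ^ e` these are the
`R`-linear maps `R^{1/p^e} → R`. -/
def IsPowInvLinear (q : ℕ) (f : R →+ R) : Prop :=
  ∀ r x, f (r ^ q * x) = r * f x

/-- The values at `x` of the `q`-inverse linear maps form an ideal. -/
def powInvIdeal (q : ℕ) (x : R) : Ideal R where
  carrier := {y | ∃ f : R →+ R, IsPowInvLinear q f ∧ f x = y}
  add_mem' := by
    rintro _ _ ⟨f, hf, rfl⟩ ⟨g, hg, rfl⟩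
    exact ⟨f + g, fun r x => by simp [hf r x, hg r x, mul_add], rfl⟩
  zero_mem' := ⟨0, fun r x => by simp, rfl⟩
  smul_mem' := by
    rintro a _ ⟨f, hf, rfl⟩
    exact ⟨(AddMonoidHom.mulLeft a).comp f, fun r x => by simp [hf r x]; ring, rfl⟩

/-- Precompose `f` with `y ↦ f₀ (x ^ (p - 1) * y)`, which fixes `x` because `f₀ (x ^ p) = x * f₀ 1`.
-/
theorem powInvIdeal_le_of_split {q : ℕ} (hp : 1 ≤ p) {f₀ : R →+ R} (hf₀ : IsPowInvLinear p f₀)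
    (h1 : f₀ 1 = 1) (x : R) : powInvIdeal q x ≤ powInvIdeal (q * p) x := by
  rintro _ ⟨f, hf, rfl⟩
  refine ⟨f.comp (f₀.comp (AddMonoidHom.mulLeft (x ^ (p - 1)))), fun r y => ?_, ?_⟩
  · have : x ^ (p - 1) * (r ^ (q * p) * y) = (r ^ q) ^ p * (x ^ (p - 1) * y) := by ring
    simp [this, hf₀ _ _, hf _ _]
  · have h : x ^ (p - 1) * x = x ^ p * 1 := by
      rw [mul_one, ← pow_succ, Nat.sub_add_cancel hp]
    have h2 : f₀ (x ^ p * 1) = x := by rw [hf₀, h1, mul_one]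
    change f (f₀ (x ^ (p - 1) * x)) = f x
    rw [h, h2]

theorem powInvIdeal_mono_of_split (hp : 1 ≤ p) {f₀ : R →+ R} (hf₀ : IsPowInvLinear p f₀)
    (h1 : f₀ 1 = 1) (x : R) {d e : ℕ} (hde : d ≤ e) :
    powInvIdeal (p ^ d) x ≤ powInvIdeal (p ^ e) x := by
  induction e, hde using Nat.le_induction with
  | base => exact le_rfl
  | succ n _ ih => exact ih.trans (by rw [pow_succ]; exact powInvIdeal_le_of_split hp hf₀ h1 x)

theorem isFFinite_iff_frobenius_finite [Fact p.Prime] [CharP R p] :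
    IsFFinite p R ↔ (frobenius R p).Finite := by
  rw [← iterateFrobenius_one]
  rfl

theorem iterateFrobenius_finite [Fact p.Prime] [CharP R p] (h : IsFFinite p R) (e : ℕ) :
    (iterateFrobenius R p e).Finite := by
  rw [isFFinite_iff_frobenius_finite] at h
  induction e with
  | zero => rw [iterateFrobenius_zero]; exact RingHom.Finite.id R
  | succ n ih =>
    rw [iterateFrobenius_add, iterateFrobenius_one]
    exact ih.comp h

/-- Finite generation of `R^{1/p^e}` as an induction principle. -/
theorem IsFFinite.exists_generators [Fact p.Prime] [CharP R p] (h : IsFFinite p R) (e : ℕ) :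
    ∃ S : Finset R, ∀ P : R → Prop, (∀ g ∈ S, P g) → P 0 → (∀ x y, P x → P y → P (x + y)) →
      (∀ r x, P x → P (r ^ p ^ e * x)) → ∀ x, P x := by
  have h1 : Module.Finite R (FrobRoot p R e) := iterateFrobenius_finite h e
  obtain ⟨S, hS⟩ := h1.fg_top
  refine ⟨S, fun P hg h0 hadd hmul x => ?_⟩
  have hx : FrobRoot.root p R e x ∈ Submodule.span R (S : Set (FrobRoot p R e)) :=
    hS ▸ Submodule.mem_top
  exact Submodule.span_induction (M := FrobRoot p R e)
    (p := fun y _ => P ((FrobRoot.root p R e).symm y)) (fun y hy => hg y hy) h0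
    (fun x y _ _ hx hy => hadd x y hx hy) (fun r y _ hy => by exact hmul r y hy) hx

theorem isFFinite_of_generators [Fact p.Prime] [CharP R p] (S : Finset R)
    (h : ∀ M : Submodule R (FrobRoot p R 1), (∀ g ∈ S, FrobRoot.root p R 1 g ∈ M) → M = ⊤) :
    IsFFinite p R :=
  ⟨⟨S, h _ fun _ hg => Submodule.subset_span hg⟩⟩

/-- Frobenius of `R` is always integral, each `x` being killed by the monic `X ^ p - x`; integral
and of finite type together give finite. It is of finite type because its composite with `k → R`
factors through the finite Frobenius of `k`. -/
theorem IsFFinite.of_finiteType {k : Type*} [Field k] [Algebra k R] [Fact p.Prime] [CharP k p]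
    [CharP R p] (hk : IsFFinite p k) [Algebra.FiniteType k R] : IsFFinite p R := by
  rw [isFFinite_iff_frobenius_finite] at hk ⊢
  have h1 : (frobenius R p).comp (algebraMap k R) = (algebraMap k R).comp (frobenius k p) := by
    ext x; simp [frobenius_def]
  have h2 : ((frobenius R p).comp (algebraMap k R)).FiniteType := by
    rw [h1]
    exact RingHom.FiniteType.comp (RingHom.finiteType_algebraMap.2 inferInstance) hk.finiteType
  refine RingHom.IsIntegral.to_finite (fun x => ?_) (RingHom.FiniteType.of_comp_finiteType h2)
  refine ⟨Polynomial.X ^ p - Polynomial.C x,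
    Polynomial.monic_X_pow_sub_C x (Fact.out : p.Prime).ne_zero, ?_⟩
  simp [frobenius_def]

/-- Strong `F`-regularity in terms of additive maps, with positive exponents. -/
structure HasPowInvMaps (p : ℕ) (R : Type*) [CommRing R] : Prop where
  exists_map : ∀ x : R, x ≠ 0 → ∃ (e : ℕ) (f : R →+ R), IsPowInvLinear (p ^ (e + 1)) f ∧ f x = 1

theorem HasPowInvMaps.isStronglyFRegular [IsDomain R] [Fact p.Prime] [CharP R p]
    (h : HasPowInvMaps p R) (hF : IsFFinite p R) : IsStronglyFRegular p R where
  isDomain := inferInstance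
  isFFinite := hF
  exists_map x hx := by
    obtain ⟨e, f, hf, h1⟩ := h.exists_map x hx
    exact ⟨e + 1,
      { toFun := fun y => f ((FrobRoot.root p R (e + 1)).symm y)
        map_add' := fun a b => f.map_add a b
        map_smul' := fun r y => hf r y }, h1⟩

/-- A `p ^ (e + 1)`-inverse linear map composed with the `e`-th Frobenius is `p`-inverse linear;
this is where the positive exponent matters. -/
theorem HasPowInvMaps.exists_split [Nontrivial R] [Fact p.Prime] [CharP R p]
    (h : HasPowInvMaps p R) : ∃ f : R →+ R, IsPowInvLinear p f ∧ f 1 = 1 := by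
  obtain ⟨e, f, hf, h1⟩ := h.exists_map 1 one_ne_zero
  refine ⟨f.comp (iterateFrobenius R p e : R →+* R).toAddMonoidHom, fun r x => ?_, ?_⟩
  · have : (r ^ p * x) ^ p ^ e = r ^ p ^ (e + 1) * x ^ p ^ e := by
      rw [mul_pow, ← pow_mul, ← pow_succ']
    simp [iterateFrobenius_def, this, hf _ _]
  · simp [h1]

end FRegular

/-! ### Locality of `F`-finiteness and of strong `F`-regularity. -/

section Gluing

variable {p : ℕ} [Fact p.Prime] {k F : Type*} [Field k] [CharP k p] [Field F] [Algebra k F]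

omit [Fact p.Prime] in
theorem charP_subalgebra (A : Subalgebra k F) : CharP A p :=
  charP_of_injective_algebraMap (algebraMap k A).injective p

/-- `A ⊆ B ⊆ A[c⁻¹]` inside `F`. -/
structure LeLocalization (A B : Subalgebra k F) (c : F) : Prop where
  le : A ≤ B
  mem : c ∈ A
  exists_pow_mul_mem : ∀ y ∈ B, ∃ n : ℕ, c ^ n * y ∈ A

theorem pow_mul_mem_of_le {A : Subalgebra k F} {c y : F} (hc : c ∈ A) {m n : ℕ} (hmn : m ≤ n)
    (h : c ^ m * y ∈ A) : c ^ n * y ∈ A := by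
  obtain ⟨d, rfl⟩ := Nat.exists_eq_add_of_le hmn
  have : c ^ (m + d) * y = c ^ d * (c ^ m * y) := by ring
  rw [this]
  exact mul_mem (pow_mem hc d) h

theorem eq_top_of_forall_pow_mem {R : Type*} [CommRing R] {C : Set R} (hC : Ideal.span C = ⊤)
    (I : Ideal R) (h : ∀ c ∈ C, ∃ n : ℕ, c ^ n ∈ I) : I = ⊤ := by
  rw [← Ideal.radical_eq_top, eq_top_iff, ← hC, Ideal.span_le]
  exact fun c hc => h c hc

omit [CharP k p] in
/-- `F`-finiteness is local. -/
theorem IsFFinite.of_localizations (A : Subalgebra k F) [CharP A p] (C : Finset A)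
    (hC : Ideal.span (C : Set A) = ⊤)
    (h : ∀ c ∈ C, ∃ (B : Subalgebra k F) (_ : CharP B p), LeLocalization A B c ∧ IsFFinite p B) :
    IsFFinite p A := by
  classical
  have key : ∀ c ∈ C, ∃ S : Finset A, ∀ M : Submodule A (FrobRoot p A 1),
      (∀ g ∈ S, FrobRoot.root p A 1 g ∈ M) →
      ∀ x : A, ∃ n : ℕ, (c ^ n) • FrobRoot.root p A 1 x ∈ M := by
    intro c hc
    obtain ⟨B, _, hB, hBF⟩ := h c hc
    obtain ⟨S, hS⟩ := hBF.exists_generators 1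
    simp only [pow_one] at hS
    choose n hn using fun g : B => hB.exists_pow_mul_mem g g.2
    -- The exponent is a multiple of `p` because a scalar `c ^ l` acts on `R^{1/p}` as
    -- multiplication by `c ^ (p * l)`.
    have hn' : ∀ g : B, (c : F) ^ (p * n g) * g ∈ A := fun g =>
      pow_mul_mem_of_le c.2 (Nat.le_mul_of_pos_left _ (Fact.out : p.Prime).pos) (hn g)
    refine ⟨S.image fun g => ⟨_, hn' g⟩, fun M hM x => ?_⟩
    have step : ∀ (n l : ℕ) (y : F), (∃ z : A, (z : F) = c ^ (p * n) * y ∧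
        FrobRoot.root p A 1 z ∈ M) → ∃ z : A, (z : F) = c ^ (p * (n + l)) * y ∧
        FrobRoot.root p A 1 z ∈ M := by
      rintro n l y ⟨z, hz, hzM⟩
      refine ⟨(c ^ l) ^ p * z, by push_cast [hz]; ring, ?_⟩
      have := M.smul_mem (c ^ l) hzM
      rwa [FrobRoot.smul_root, pow_one] at this
    have main := hS (fun y => ∃ (n : ℕ) (z : A), (z : F) = (c : F) ^ (p * n) * y ∧
      FrobRoot.root p A 1 z ∈ M) ?_ ?_ ?_ ?_ ⟨x, hB.le x.2⟩
    · obtain ⟨n, z, hz, hzM⟩ := main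
      have hzx : z = (c ^ n) ^ p * x := Subtype.ext (by push_cast [hz]; ring)
      refine ⟨n, ?_⟩
      rwa [FrobRoot.smul_root, pow_one, ← hzx]
    · intro g hg
      exact ⟨n g, ⟨_, hn' g⟩, rfl, hM _ (Finset.mem_image_of_mem _ hg)⟩
    · exact ⟨0, 0, by simp, by simp⟩
    · rintro y y' ⟨n, hy⟩ ⟨n', hy'⟩
      obtain ⟨z, hz, hzM⟩ := step n n' y hy
      obtain ⟨z', hz', hzM'⟩ := step n' n y' hy'
      refine ⟨n + n', z + z', ?_, by rw [map_add]; exact M.add_mem hzM hzM'⟩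
      push_cast [hz, hz', add_comm n' n]
      ring
    · rintro r y ⟨n, z, hz, hzM⟩
      obtain ⟨l, hl⟩ := hB.exists_pow_mul_mem r r.2
      refine ⟨n + l, ⟨_, hl⟩ ^ p * z, by push_cast [hz]; ring, ?_⟩
      have := M.smul_mem ⟨_, hl⟩ hzM
      rwa [FrobRoot.smul_root, pow_one] at this
  choose! S hS using key
  refine isFFinite_of_generators (C.biUnion S) fun M hM => ?_
  rw [Submodule.eq_top_iff']
  intro x
  -- The pullback of `M` is the ideal of scalars that send `x` into `M`; it contains a power of
  -- every `c`.
  have := eq_top_of_forall_pow_mem hC (M.comap (LinearMap.toSpanSingleton A (FrobRoot p A 1) x))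
    fun c hc => hS c hc M (fun g hg => hM g (Finset.mem_biUnion.2 ⟨c, hc, hg⟩)) x
  simpa using (Ideal.eq_top_iff_one _).1 this

omit [CharP k p] in
-- Since `A^{1/p^e}` is finitely generated over `A`, a single power `c ^ N` clears the denominators
-- of `f` on all of `A`. Then `c ^ N * f` is an inverse linear map on `A` with value `c ^ N` at `x`.
theorem LeLocalization.exists_pow_mem_powInvIdeal {A B : Subalgebra k F} [CharP A p] {c : F}
    (h : LeLocalization A B c) (hA : IsFFinite p A) {e : ℕ} {f : B →+ B}
    (hf : IsPowInvLinear (p ^ e) f) {x : A} (hx : f ⟨x, h.le x.2⟩ = 1) :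
    ∃ n : ℕ, (⟨c, h.mem⟩ : A) ^ n ∈ powInvIdeal (p ^ e) x := by
  obtain ⟨S, hS⟩ := hA.exists_generators e
  choose n hn using fun g : A => h.exists_pow_mul_mem _ (f ⟨g, h.le g.2⟩).2
  set N := ∑ g ∈ S, n g
  have hN : ∀ y : A, c ^ N * (f ⟨y, h.le y.2⟩ : F) ∈ A := by
    refine hS _ ?_ ?_ ?_ ?_
    · exact fun g hg => pow_mul_mem_of_le h.mem (Finset.single_le_sum (by simp) hg) (hn g)
    · have : (⟨(0 : A), h.le (0 : A).2⟩ : B) = 0 := rfl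
      rw [this, map_zero]
      simp
    · intro y z hy hz
      have : (⟨(y + z : A), h.le (y + z : A).2⟩ : B) = ⟨y, h.le y.2⟩ + ⟨z, h.le z.2⟩ := rfl
      rw [this, map_add]
      push_cast
      rw [mul_add]
      exact add_mem hy hz
    · intro r y hy
      have : (⟨(r ^ p ^ e * y : A), h.le (r ^ p ^ e * y : A).2⟩ : B) =
        ⟨r, h.le r.2⟩ ^ p ^ e * ⟨y, h.le y.2⟩ := rfl
      rw [this, hf]
      push_cast
      rw [mul_left_comm]
      exact mul_mem r.2 hy
  refine ⟨N, ⟨⟨fun y => ⟨_, hN y⟩, ?_⟩, ?_⟩, fun r y => ?_, ?_⟩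
  · have : (⟨(0 : A), h.le (0 : A).2⟩ : B) = 0 := rfl
    ext
    simp only [this, map_zero]
    simp
  · intro y z
    have : (⟨(y + z : A), h.le (y + z : A).2⟩ : B) = ⟨y, h.le y.2⟩ + ⟨z, h.le z.2⟩ := rfl
    ext
    simp only [this, map_add]
    push_cast
    ring
  · have : (⟨(r ^ p ^ e * y : A), h.le (r ^ p ^ e * y : A).2⟩ : B) =
      ⟨r, h.le r.2⟩ ^ p ^ e * ⟨y, h.le y.2⟩ := rfl
    ext
    simp only [AddMonoidHom.coe_mk, ZeroHom.coe_mk, this, hf _ _]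
    push_cast
    ring
  · ext
    simp [hx]

/-- Strong `F`-regularity is local. -/
theorem HasPowInvMaps.of_localizations (A : Subalgebra k F) [CharP A p] (hA : IsFFinite p A)
    (C : Finset A) (hC : Ideal.span (C : Set A) = ⊤)
    (h : ∀ c ∈ C, ∃ B : Subalgebra k F, LeLocalization A B c ∧ HasPowInvMaps p B) :
    HasPowInvMaps p A := by
  have hp := (Fact.out : p.Prime).one_le
  have split : ∃ f : A →+ A, IsPowInvLinear p f ∧ f 1 = 1 := by
    have : powInvIdeal p (1 : A) = ⊤ := eq_top_of_forall_pow_mem hC _ fun c hc => by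
      obtain ⟨B, hB, hBm⟩ := h c hc
      have := charP_subalgebra (p := p) B
      obtain ⟨f, hf, h1⟩ := hBm.exists_split
      have := hB.exists_pow_mem_powInvIdeal hA (e := 1) (f := f) (x := 1) (by rwa [pow_one]) h1
      rwa [pow_one] at this
    exact (Ideal.eq_top_iff_one _).1 this
  obtain ⟨f₀, hf₀, h1⟩ := split
  refine ⟨fun x hx => ?_⟩
  have key : ∀ c ∈ C, ∃ e n : ℕ, c ^ n ∈ powInvIdeal (p ^ e) x := by
    intro c hc
    obtain ⟨B, hB, hBm⟩ := h c hc
    obtain ⟨e, f, hf, h1⟩ := hBm.exists_map ⟨x, hB.le x.2⟩ (by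
      intro h0; exact hx (Subtype.ext (congrArg Subtype.val h0 :)))
    exact ⟨e + 1, hB.exists_pow_mem_powInvIdeal hA hf h1⟩
  choose! e n hen using key
  -- The ideals grow with the exponent, so the sum of the `e c` serves every `c`; the added `1`
  -- keeps the exponent positive.
  have := eq_top_of_forall_pow_mem hC (powInvIdeal (p ^ (∑ c ∈ C, e c + 1)) x) fun c hc =>
    ⟨n c, powInvIdeal_mono_of_split hp hf₀ h1 x
      ((Finset.single_le_sum (f := e) (by simp) hc).trans (Nat.le_succ _)) (hen c hc)⟩
  obtain ⟨f, hf, h⟩ := (Ideal.eq_top_iff_one _).1 this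
  exact ⟨_, f, hf, h⟩

end Gluing

/-! ### Clearing denominators, and gluing over two comaximal elements. -/

section Localization

variable {k F : Type*} [Field k] [Field F] [Algebra k F]

theorem exists_pow_mul_mem_of_mem_adjoin {A : Subalgebra k F} {w : F} (hw : w ∈ A) {S : Set F}
    (hS : ∀ y ∈ S, ∃ n : ℕ, w ^ n * y ∈ A) {y : F} (hy : y ∈ Algebra.adjoin k S) :
    ∃ n : ℕ, w ^ n * y ∈ A := by
  induction hy using Algebra.adjoin_induction with
  | mem y h => exact hS y h
  | algebraMap r => exact ⟨0, by simp⟩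
  | add y z _ _ hy hz =>
    obtain ⟨m, hm⟩ := hy
    obtain ⟨n, hn⟩ := hz
    refine ⟨m + n, ?_⟩
    rw [mul_add]
    exact add_mem (pow_mul_mem_of_le hw (by omega) hm) (pow_mul_mem_of_le hw (by omega) hn)
  | mul y z _ _ hy hz =>
    obtain ⟨m, hm⟩ := hy
    obtain ⟨n, hn⟩ := hz
    refine ⟨m + n, ?_⟩
    have : w ^ (m + n) * (y * z) = (w ^ m * y) * (w ^ n * z) := by ring
    rw [this]
    exact mul_mem hm hn

/-- If `x, z` generate the unit ideal of `A`, then `A[x⁻¹] ∩ A[z⁻¹] = A`. -/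
theorem mem_of_pow_mul_mem {A : Subalgebra k F} {x z a b u y : F} (hx : x ∈ A) (hz : z ∈ A)
    (ha : a ∈ A) (hb : b ∈ A) (hu : u⁻¹ ∈ A) (hu0 : u ≠ 0) (h : u = x * a + z * b) {m n : ℕ}
    (hm : x ^ m * y ∈ A) (hn : z ^ n * y ∈ A) : y ∈ A := by
  have hco : IsCoprime (⟨x, hx⟩ : A) ⟨z, hz⟩ := by
    refine ⟨⟨a, ha⟩ * ⟨u⁻¹, hu⟩, ⟨b, hb⟩ * ⟨u⁻¹, hu⟩, Subtype.ext ?_⟩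
    push_cast
    field_simp
    rw [h]; ring
  obtain ⟨c, d, hcd⟩ := hco.pow (m := m) (n := n)
  have hcd' : (c : F) * x ^ m + d * z ^ n = 1 := by simpa using congrArg Subtype.val hcd
  have : y = c * (x ^ m * y) + d * (z ^ n * y) := by
    linear_combination (-y) * hcd'
  rw [this]
  exact add_mem (mul_mem c.2 hm) (mul_mem d.2 hn)

end Localization

/-! ### Laurent polynomial rings inside the ambient field. -/

section Laurent

variable {k F ι : Type*} [Field k] [Field F] [Algebra k F]

/-- The Laurent polynomial subring `k[x i, (x i)⁻¹ : i ∈ V]` of `F`. -/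
def laurentOn (k : Type*) {F ι : Type*} [Field k] [Field F] [Algebra k F] (x : ι → F)
    (V : Set ι) : Subalgebra k F :=
  Algebra.adjoin k {y | ∃ i ∈ V, y = x i ∨ y = (x i)⁻¹}

variable {x : ι → F} {V : Set ι}

theorem mem_laurentOn {i : ι} (hi : i ∈ V) : x i ∈ laurentOn k x V :=
  Algebra.subset_adjoin ⟨i, hi, Or.inl rfl⟩

theorem inv_mem_laurentOn {i : ι} (hi : i ∈ V) : (x i)⁻¹ ∈ laurentOn k x V :=
  Algebra.subset_adjoin ⟨i, hi, Or.inr rfl⟩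

theorem laurentOn_le {A : Subalgebra k F} (h : ∀ i ∈ V, x i ∈ A ∧ (x i)⁻¹ ∈ A) :
    laurentOn k x V ≤ A := by
  refine Algebra.adjoin_le ?_
  rintro _ ⟨i, hi, rfl | rfl⟩
  exacts [(h i hi).1, (h i hi).2]

theorem zpow_mem_of_mem {A : Subalgebra k F} {y : F} (h : y ∈ A) (h' : y⁻¹ ∈ A) (n : ℤ) :
    y ^ n ∈ A := by
  obtain ⟨m, rfl | rfl⟩ := n.eq_nat_or_neg
  · simpa using pow_mem h m
  · rw [zpow_neg, zpow_natCast, ← inv_pow]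
    exact pow_mem h' m

theorem prod_zpow_mem_laurentOn [Fintype ι] (a : ι → ℤ) (ha : ∀ i, i ∉ V → a i = 0) :
    ∏ i, x i ^ a i ∈ laurentOn k x V := by
  refine prod_mem fun i _ => ?_
  by_cases hi : i ∈ V
  · exact zpow_mem_of_mem (mem_laurentOn hi) (inv_mem_laurentOn hi) _
  · simp [ha i hi, one_mem]

theorem prod_pow_mem_laurentOn [Fintype ι] (a : ι → ℕ) (ha : ∀ i, i ∉ V → a i = 0) :
    ∏ i, x i ^ a i ∈ laurentOn k x V := by
  simpa using prod_zpow_mem_laurentOn (k := k) (x := x) (V := V) (fun i => (a i : ℤ))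
    (by simpa using ha)

theorem inv_prod_pow_mem_laurentOn [Fintype ι] (a : ι → ℕ) (ha : ∀ i, i ∉ V → a i = 0) :
    (∏ i, x i ^ a i)⁻¹ ∈ laurentOn k x V := by
  simpa using prod_zpow_mem_laurentOn (k := k) (x := x) (V := V) (fun i => -(a i : ℤ))
    (by simpa using ha)

variable [Fintype ι]

/-- Evaluation of Laurent polynomials at nonzero elements of a field. -/
noncomputable def laurentEval (k : Type*) {F ι : Type*} [Field k] [Field F] [Algebra k F] [Fintype ι]
    (x : ι → F) (hx : ∀ i, x i ≠ 0) : AddMonoidAlgebra k (ι → ℤ) →ₐ[k] F :=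
  AddMonoidAlgebra.lift k F (ι → ℤ)
    { toFun := fun a => ∏ i, x i ^ a.toAdd i
      map_one' := by simp
      map_mul' := fun a b => by simp [zpow_add₀ (hx _), Finset.prod_mul_distrib] }

theorem laurentEval_single (hx : ∀ i, x i ≠ 0) (a : ι → ℤ) (c : k) :
    laurentEval k x hx (AddMonoidAlgebra.single a c) = algebraMap k F c * ∏ i, x i ^ a i := by
  simp [laurentEval, AddMonoidAlgebra.lift_single, Algebra.smul_def]

theorem laurentEval_apply (hx : ∀ i, x i ≠ 0) (f : AddMonoidAlgebra k (ι → ℤ)) :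
    laurentEval k x hx f = ∑ a ∈ f.coeff.support, algebraMap k F (f.coeff a) * ∏ i, x i ^ a i := by
  conv_lhs => rw [← AddMonoidAlgebra.sum_coeff_single f, Finsupp.sum]
  rw [map_sum]
  simp [laurentEval_single]

theorem range_laurentEval (hx : ∀ i, x i ≠ 0) :
    (laurentEval k x hx).range = laurentOn k x Set.univ := by
  classical
  apply le_antisymm
  · rintro _ ⟨f, rfl⟩
    change laurentEval k x hx f ∈ _
    rw [laurentEval_apply]
    exact sum_mem fun a _ => mul_mem (Subalgebra.algebraMap_mem _ _)
      (prod_zpow_mem_laurentOn a (by simp))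
  · refine laurentOn_le fun i _ => ⟨⟨AddMonoidAlgebra.single (Pi.single i 1) 1, ?_⟩,
      ⟨AddMonoidAlgebra.single (Pi.single i (-1)) 1, ?_⟩⟩
    · change laurentEval k x hx _ = _
      rw [laurentEval_single, Finset.prod_eq_single i] <;> simp +contextual
    · change laurentEval k x hx _ = _
      rw [laurentEval_single, Finset.prod_eq_single i] <;> simp +contextual

/-- Multiplying a relation by `∏ i, x i ^ N`, with `N` at least every absolute exponent that occurs,
turns it into a polynomial relation among the algebraically independent `x i`. -/
theorem laurentEval_injective (hx : ∀ i, x i ≠ 0) (h : AlgebraicIndependent k x) :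
    Function.Injective (laurentEval k x hx) := by
  classical
  rw [injective_iff_map_eq_zero]
  intro f hf
  by_contra hf0
  have hsupp : f.coeff.support.Nonempty := by
    rw [Finsupp.support_nonempty_iff]
    simpa using hf0
  obtain ⟨a₀, ha₀⟩ := hsupp
  set N : ℕ := ∑ a ∈ f.coeff.support, ∑ i, (a i).natAbs with hN
  have hle : ∀ a ∈ f.coeff.support, ∀ i, 0 ≤ a i + N := by
    intro a ha i
    have h1 : (a i).natAbs ≤ ∑ i, (a i).natAbs :=
      Finset.single_le_sum (f := fun i => (a i).natAbs) (by simp) (Finset.mem_univ i)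
    have h2 : ∑ i, (a i).natAbs ≤ N :=
      Finset.single_le_sum (f := fun a : ι → ℤ => ∑ i, (a i).natAbs) (by simp) ha
    omega
  let m : (ι → ℤ) → (ι →₀ ℕ) := fun a => Finsupp.equivFunOnFinite.symm fun i => (a i + N).toNat
  let P : MvPolynomial ι k := ∑ a ∈ f.coeff.support, MvPolynomial.monomial (m a) (f.coeff a)
  have hP : MvPolynomial.aeval x P = (∏ i, x i ^ N) * laurentEval k x hx f := by
    simp only [P, map_sum, MvPolynomial.aeval_monomial]
    rw [laurentEval_apply, Finset.mul_sum]
    refine Finset.sum_congr rfl fun a ha => ?_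
    rw [Finsupp.prod_fintype _ _ (by simp), mul_left_comm, ← Finset.prod_mul_distrib]
    congr 1
    refine Finset.prod_congr rfl fun i _ => ?_
    simp only [m, Finsupp.equivFunOnFinite_symm_apply_apply]
    rw [← zpow_natCast, Int.toNat_of_nonneg (hle a ha i), add_comm, zpow_add₀ (hx i), zpow_natCast]
  rw [hf, mul_zero] at hP
  have hP0 : P = 0 := (map_eq_zero_iff _ h).1 hP
  have := congrArg (MvPolynomial.coeff (m a₀)) hP0
  simp only [P, MvPolynomial.coeff_sum, MvPolynomial.coeff_monomial, MvPolynomial.coeff_zero] at this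
  rw [Finset.sum_eq_single a₀] at this
  · simp at this
    simp [this] at ha₀
  · intro a ha hne
    rw [if_neg]
    intro hm
    apply hne
    funext i
    have := DFunLike.congr_fun hm i
    simp only [m, Finsupp.equivFunOnFinite_symm_apply_apply] at this
    have h1 := hle a ha i
    have h2 := hle a₀ ha₀ i
    omega
  · intro h; exact absurd ha₀ h

end Laurent

/-! ### Coprimality of binomials in a group algebra. -/

section Coprime

variable {k G : Type*} [Field k] [AddCommGroup G]

open AddMonoidAlgebra

theorem coeff_one_add_single_mul (u w : G) (a : AddMonoidAlgebra k G) :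
    ((1 + single u 1) * a).coeff w = a.coeff w + a.coeff (w - u) := by
  rw [add_mul, one_mul, coeff_add, Finsupp.add_apply, coeff_single_mul_apply]
  simp [sub_eq_neg_add]

/-- `1 + U` and `1 + V` are coprime if a linear form vanishes at `u` but not at `v`. -/
theorem one_add_single_dvd_of_dvd_mul (l : G →+ ℤ) {u v : G} (hu : l u = 0) (hv : 0 < l v)
    {a b : AddMonoidAlgebra k G} (h : (1 + single u 1) * a = (1 + single v 1) * b) :
    (1 + single u (1 : k)) ∣ b := by
  classical
  induction hn : b.coeff.support.card using Nat.strong_induction_on generalizing a b with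
  | _ n ih =>
  subst hn
  by_cases hb : b = 0
  · simp [hb]
  have hsupp : b.coeff.support.Nonempty := by
    rw [Finsupp.support_nonempty_iff]
    simpa using hb
  obtain ⟨w₀, hw₀, hmin⟩ := Finset.exists_min_image _ l hsupp
  -- Compare the parts of lowest `l`-degree of `b`: multiplication by `U` preserves the degree and
  -- multiplication by `V` raises it, so the lowest part `b₀` is `(1 + U) * a₀`. Subtracting it
  -- shrinks the support of `b` and keeps the shape of the equation.
  let b₀ : AddMonoidAlgebra k G := ofCoeff (b.coeff.filter fun w => l w = l w₀)
  let a₀ : AddMonoidAlgebra k G := ofCoeff (a.coeff.filter fun w => l w = l w₀)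
  have hlow : ∀ w, l w < l w₀ → b.coeff w = 0 := by
    intro w hw
    by_contra h
    exact absurd (hmin w (Finsupp.mem_support_iff.2 h)) (by omega)
  have h0 : b₀ = (1 + single u 1) * a₀ := by
    ext w
    rw [coeff_one_add_single_mul]
    simp only [a₀, b₀, Finsupp.filter_apply, map_sub, hu, sub_zero]
    split_ifs with hw
    · have := congrArg (fun f => f.coeff w) h
      simp only [coeff_one_add_single_mul] at this
      rw [this, hlow (w - v) (by rw [map_sub]; omega), add_zero]
    · simp
  have h1 : (1 + single u 1) * (a - (1 + single v 1) * a₀) = (1 + single v 1) * (b - b₀) := by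
    rw [mul_sub, mul_sub, h, h0]; ring
  have hlt : (b - b₀).coeff.support.card < b.coeff.support.card := by
    apply Finset.card_lt_card
    refine ⟨fun w hw => ?_, fun hsub => ?_⟩
    · rw [Finsupp.mem_support_iff] at hw ⊢
      intro h
      apply hw
      simp [b₀, coeff_sub, Finsupp.filter_apply, h]
    · have := hsub hw₀
      simp [b₀, coeff_sub] at this
  have := ih _ hlt h1 rfl
  rw [← sub_add_cancel b b₀]
  exact dvd_add this ⟨a₀, h0⟩

end Coprime

/-! ### Quiver mutation through the signed adjacency matrix. -/

namespace ClusterQuiver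

variable {ι : Type*}

/-- The signed adjacency matrix of a quiver. -/
def signed (Q : ClusterQuiver ι) (i j : ι) : ℤ := Q.arrows i j - Q.arrows j i

theorem signed_self (Q : ClusterQuiver ι) (i : ι) : Q.signed i i = 0 := by
  simp [signed]

/-- In the absence of 2-cycles the signed matrix determines the quiver, so identities between
mutated quivers can be checked on signed entries, free of truncated subtraction. -/
theorem arrows_eq_toNat (Q : ClusterQuiver ι) (i j : ι) : Q.arrows i j = (Q.signed i j).toNat := by
  have := Q.no_two_cycle i j
  simp only [signed]
  omega

theorem ext_signed {Q Q' : ClusterQuiver ι} (h : ∀ i j, Q.signed i j = Q'.signed i j) : Q = Q' := by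
  ext i j
  rw [arrows_eq_toNat, arrows_eq_toNat, h]

variable [DecidableEq ι]

theorem arrows_mutate_left (Q : ClusterQuiver ι) (k j : ι) :
    (Q.mutate k).arrows k j = Q.arrows j k := by
  have := Q.no_two_cycle k j
  simp only [mutate, cancel, reverseAt, addPaths, Q.no_loop]
  simp
  omega

theorem arrows_mutate_right (Q : ClusterQuiver ι) (k i : ι) :
    (Q.mutate k).arrows i k = Q.arrows k i := by
  have := Q.no_two_cycle k i
  simp only [mutate, cancel, reverseAt, addPaths, Q.no_loop]
  simp
  omega

theorem signed_mutate_left (Q : ClusterQuiver ι) (k j : ι) :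
    (Q.mutate k).signed k j = - Q.signed k j := by
  simp [signed, arrows_mutate_left, arrows_mutate_right]

theorem signed_mutate_right (Q : ClusterQuiver ι) (k i : ι) :
    (Q.mutate k).signed i k = - Q.signed i k := by
  simp [signed, arrows_mutate_left, arrows_mutate_right]

theorem signed_mutate_of_ne (Q : ClusterQuiver ι) {k i j : ι} (hi : i ≠ k) (hj : j ≠ k) :
    (Q.mutate k).signed i j =
      Q.signed i j + (Q.arrows i k * Q.arrows k j - Q.arrows j k * Q.arrows k i) := by
  simp only [signed, mutate, cancel, reverseAt, addPaths, hi, hj, or_self, if_false]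
  have (u v : ℕ) : ((u - v : ℕ) : ℤ) - ((v - u : ℕ) : ℤ) = u - v := by omega
  rw [this]
  push_cast
  ring

theorem mutate_mutate (Q : ClusterQuiver ι) (k : ι) : (Q.mutate k).mutate k = Q := by
  refine ext_signed fun i j => ?_
  by_cases hi : i = k
  · subst hi; simp [signed_mutate_left]
  by_cases hj : j = k
  · subst hj; simp [signed_mutate_right]
  rw [signed_mutate_of_ne _ hi hj, signed_mutate_of_ne _ hi hj]
  simp only [arrows_mutate_left, arrows_mutate_right]
  ring

/-- The opposite quiver. -/
def op (Q : ClusterQuiver ι) : ClusterQuiver ι where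
  arrows i j := Q.arrows j i
  no_loop := Q.no_loop
  no_two_cycle i j := Q.no_two_cycle j i

omit [DecidableEq ι] in
theorem signed_op (Q : ClusterQuiver ι) (i j : ι) : Q.op.signed i j = Q.signed j i := rfl

theorem op_mutate (Q : ClusterQuiver ι) (k : ι) : Q.op.mutate k = (Q.mutate k).op := by
  refine ext_signed fun i j => ?_
  rw [signed_op]
  by_cases hi : i = k
  · subst hi; simp [signed_mutate_left, signed_mutate_right, signed_op]
  by_cases hj : j = k
  · subst hj; simp [signed_mutate_left, signed_mutate_right, signed_op]
  rw [signed_mutate_of_ne _ hi hj, signed_mutate_of_ne _ hj hi, signed_op]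
  simp only [op]
  ring

end ClusterQuiver

/-! ### Involutivity of seed mutation, and invariance of full rank. -/

namespace Seed

variable {k F ι : Type*} [Field k] [Field F] [Algebra k F]

theorem ext_data {s t : Seed k F ι} (h1 : s.quiver = t.quiver) (h2 : s.x = t.x)
    (h3 : s.frozen = t.frozen) : s = t := by
  cases s; cases t; simp_all

/-- The seed with the opposite quiver. -/
def op (s : Seed k F ι) : Seed k F ι where
  quiver := s.quiver.op
  x := s.x
  frozen := s.frozen
  algebraicIndependent := s.algebraicIndependent
  adjoin_eq_top := s.adjoin_eq_top
  touches i hi := by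
    obtain ⟨j, hj⟩ := s.touches i hi
    exact ⟨j, hj.symm⟩

variable [Fintype ι]

theorem exchangePoly_op (s : Seed k F ι) (j : ι) : s.op.exchangePoly j = s.exchangePoly j :=
  add_comm _ _

variable [DecidableEq ι]

theorem op_mutate (s : Seed k F ι) (j : ι) (hj : j ∉ s.frozen) :
    s.op.mutate j hj = (s.mutate j hj).op := by
  refine ext_data (s.quiver.op_mutate j) ?_ rfl
  simp only [mutate, mutateCluster, exchangePoly_op]
  rfl

theorem mutate_x_self (s : Seed k F ι) {j : ι} (hj : j ∉ s.frozen) :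
    (s.mutate j hj).x j = s.exchangePoly j * (s.x j)⁻¹ := by
  simp [mutate, mutateCluster]

theorem x_mul_mutate_x (s : Seed k F ι) {j : ι} (hj : j ∉ s.frozen) :
    s.x j * (s.mutate j hj).x j = s.exchangePoly j := by
  rw [mutate_x_self]
  have := s.x_ne_zero j
  field_simp

theorem mutate_x_of_ne (s : Seed k F ι) {i j : ι} (hj : j ∉ s.frozen) (hij : i ≠ j) :
    (s.mutate j hj).x i = s.x i := by
  simp [mutate, mutateCluster, hij]

/-- A monomial not involving `x j` is unchanged by mutation at `j`. -/
theorem prod_mutate_x (s : Seed k F ι) {j : ι} (hj : j ∉ s.frozen) {a : ι → ℕ} (ha : a j = 0) :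
    ∏ i, (s.mutate j hj).x i ^ a i = ∏ i, s.x i ^ a i := by
  refine Finset.prod_congr rfl fun i _ => ?_
  by_cases h : i = j
  · subst h; simp [ha]
  · rw [mutate_x_of_ne s hj h]

theorem exchangePoly_mutate_self (s : Seed k F ι) {j : ι} (hj : j ∉ s.frozen) :
    (s.mutate j hj).exchangePoly j = s.exchangePoly j := by
  have h1 : ∀ i, (s.mutate j hj).quiver.arrows i j = s.quiver.arrows j i :=
    s.quiver.arrows_mutate_right j
  have h2 : ∀ i, (s.mutate j hj).quiver.arrows j i = s.quiver.arrows i j :=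
    s.quiver.arrows_mutate_left j
  simp only [exchangePoly, h1, h2]
  rw [prod_mutate_x s hj (s.quiver.no_loop j),
    prod_mutate_x s hj (a := fun i => s.quiver.arrows i j) (s.quiver.no_loop j), add_comm]

theorem notMem_frozen_mutate (s : Seed k F ι) {i j : ι} (hi : i ∉ s.frozen) (hj : j ∉ s.frozen) :
    i ∉ (s.mutate j hj).frozen := hi

theorem mutate_mutate (s : Seed k F ι) {j : ι} (hj : j ∉ s.frozen) :
    (s.mutate j hj).mutate j (s.notMem_frozen_mutate hj hj) = s := by
  refine ext_data (s.quiver.mutate_mutate j) ?_ rfl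
  funext i
  by_cases hi : i = j
  · subst hi
    rw [mutate_x_self, mutate_x_self, exchangePoly_mutate_self]
    have h1 := s.x_ne_zero i
    have h2 := s.exchangePoly_ne_zero hj
    field_simp
  · rw [mutate_x_of_ne _ _ hi, mutate_x_of_ne _ _ hi]

theorem MutationEquiv.symm {s t : Seed k F ι} (h : s.MutationEquiv t) : t.MutationEquiv s := by
  induction h with
  | refl => exact Relation.ReflTransGen.refl
  | tail _ h ih =>
    obtain ⟨j, hj, rfl⟩ := h
    exact Relation.ReflTransGen.head ⟨j, hj, (mutate_mutate _ hj).symm⟩ ih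

theorem MutationEquiv.mutate (s : Seed k F ι) {j : ι} (hj : j ∉ s.frozen) :
    s.MutationEquiv (s.mutate j hj) :=
  Relation.ReflTransGen.single ⟨j, hj, rfl⟩

theorem MutationEquiv.frozen_eq {s t : Seed k F ι} (h : s.MutationEquiv t) :
    t.frozen = s.frozen := by
  induction h with
  | refl => rfl
  | tail _ h ih =>
    obtain ⟨j, hj, rfl⟩ := h
    exact ih

theorem MutationEquiv.x_eq {s t : Seed k F ι} (h : s.MutationEquiv t) {i : ι}
    (hi : i ∈ s.frozen) : t.x i = s.x i := by
  induction h with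
  | refl => rfl
  | tail h0 h ih =>
    obtain ⟨j, hj, rfl⟩ := h
    rw [mutate_x_of_ne, ih]
    rintro rfl
    exact hj (MutationEquiv.frozen_eq h0 ▸ hi)

theorem MutationEquiv.clusterAlgebra_eq {s t : Seed k F ι} (h : s.MutationEquiv t) :
    t.clusterAlgebra = s.clusterAlgebra := by
  have h1 : t.clusterVariables = s.clusterVariables := by
    ext y
    exact ⟨fun ⟨u, hu, hy⟩ => ⟨u, h.trans hu, hy⟩, fun ⟨u, hu, hy⟩ => ⟨u, h.symm.trans hu, hy⟩⟩
  rw [clusterAlgebra, clusterAlgebra, h1, h.frozen_eq]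
  congr 2
  ext y
  constructor <;> rintro ⟨i, hi, rfl⟩ <;> exact ⟨i, hi, by rw [h.x_eq hi]⟩

/-- The columns of the signed adjacency matrix at the mutable vertices are linearly independent. -/
def FullRank (s : Seed k F ι) : Prop :=
  ∀ c : ι → ℤ, (∀ i ∈ s.frozen, c i = 0) → (∀ i, ∑ j, s.quiver.signed i j * c j = 0) → c = 0

theorem FullRank.mutate {s : Seed k F ι} (h : s.FullRank) {m : ι} (hm : m ∉ s.frozen) :
    (s.mutate m hm).FullRank := by
  intro c hc0 hc
  have hrow : ∑ j, s.quiver.signed m j * c j = 0 := by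
    have := hc m
    change ∑ j, (s.quiver.mutate m).signed m j * c j = 0 at this
    simpa [ClusterQuiver.signed_mutate_left] using this
  -- Off row and column `m`, the mutated entry is `b i j + a i m * b m j + b i m * a j m`, where `a`
  -- counts arrows and `b` is signed. Row `m` annihilates `c`, so the middle term drops out, and the
  -- remaining relation is absorbed into a new value at `m`. Thus a relation for the mutated matrix
  -- becomes a relation for the original one.
  let d : ι → ℤ := Function.update c m (-c m + ∑ j, s.quiver.arrows j m * c j)
  have hd : ∀ i, ∑ j, s.quiver.signed i j * d j = ∑ j, s.quiver.signed i j * c j +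
      s.quiver.signed i m * (-2 * c m + ∑ j, s.quiver.arrows j m * c j) := by
    intro i
    rw [← Finset.add_sum_erase _ _ (Finset.mem_univ m),
      ← Finset.add_sum_erase (a := m) _ (fun j => s.quiver.signed i j * c j) (Finset.mem_univ m)]
    have : ∑ j ∈ Finset.univ.erase m, s.quiver.signed i j * d j =
        ∑ j ∈ Finset.univ.erase m, s.quiver.signed i j * c j :=
      Finset.sum_congr rfl fun j hj => by simp [d, Finset.ne_of_mem_erase hj]
    rw [this]
    simp only [d, Function.update_self]
    ring
  have hd0 : d = 0 := by
    refine h d (fun i hi => ?_) fun i => ?_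
    · have : i ≠ m := by rintro rfl; exact hm hi
      simpa [d, this] using hc0 i hi
    · rw [hd]
      by_cases hi : i = m
      · subst hi; simp [hrow, ClusterQuiver.signed_self]
      · have h1 := hc i
        change ∑ j, (s.quiver.mutate m).signed i j * c j = 0 at h1
        have h2 : ∀ j, (s.quiver.mutate m).signed i j * c j = s.quiver.signed i j * c j +
            (s.quiver.arrows i m * (s.quiver.signed m j * c j) +
              s.quiver.signed i m * (s.quiver.arrows j m * c j)) -
            (if j = m then 2 * s.quiver.signed i m * c m else 0) := by
          intro j
          by_cases hj : j = m
          · subst hj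
            rw [ClusterQuiver.signed_mutate_right, ClusterQuiver.signed_self, s.quiver.no_loop]
            simp; ring
          · rw [ClusterQuiver.signed_mutate_of_ne _ hi hj]
            simp only [ClusterQuiver.signed, hj, if_false]
            ring
        simp only [h2, Finset.sum_sub_distrib, Finset.sum_add_distrib, ← Finset.mul_sum, hrow,
          Finset.sum_ite_eq', Finset.mem_univ, if_true] at h1
        linear_combination h1
  have hne : ∀ j, j ≠ m → c j = 0 := fun j hj => by simpa [d, hj] using congrFun hd0 j
  funext j
  by_cases hj : j = m
  · subst hj
    have h1 := congrFun hd0 j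
    simp only [d, Function.update_self] at h1
    rw [Finset.sum_eq_zero] at h1
    · simpa using h1
    · intro i _
      by_cases hi : i = j
      · subst hi; simp [s.quiver.no_loop]
      · simp [hne i hi]
  · exact hne j hj

theorem FullRank.mutationEquiv {s t : Seed k F ι} (h : s.FullRank) (hst : s.MutationEquiv t) :
    t.FullRank := by
  induction hst with
  | refl => exact h
  | tail _ h ih =>
    obtain ⟨j, hj, rfl⟩ := h
    exact ih.mutate hj

end Seed

/-! ### Intersection of two Laurent rings in one variable. -/

section OneVariable

variable {k F : Type*} [Field k] [Field F] [Algebra k F]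

theorem exists_pow_mul_eq_aeval {B : Subalgebra k F} {x y : F} (hx : x ≠ 0)
    (h : y ∈ Algebra.adjoin k ((B : Set F) ∪ {x, x⁻¹})) :
    ∃ (n : ℕ) (f : Polynomial B), x ^ n * y = Polynomial.aeval x f := by
  have := exists_pow_mul_mem_of_mem_adjoin (w := x)
    (A := (Polynomial.aeval (R := B) x).range.restrictScalars k) ⟨Polynomial.X, by simp⟩ ?_ h
  · obtain ⟨n, f, hf⟩ := this
    exact ⟨n, f, hf.symm⟩
  · rintro z (hz | rfl | rfl)
    · exact ⟨0, Polynomial.C ⟨z, hz⟩, by simp⟩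
    · exact ⟨0, Polynomial.X, by simp⟩
    · exact ⟨1, 1, by simp [hx]⟩

/-- `B[x, x⁻¹] ∩ B[x', x'⁻¹] = B[x, x']` if `x` is transcendental over `B` and `x * x' ∈ B`. -/
theorem mem_adjoin_pair_of_mem_laurent {B : Subalgebra k F} {x x' : F} (hx : Transcendental B x)
    (hx' : x' ≠ 0) (hP : x * x' ∈ B) {y : F}
    (h1 : y ∈ Algebra.adjoin k ((B : Set F) ∪ {x, x⁻¹}))
    (h2 : y ∈ Algebra.adjoin k ((B : Set F) ∪ {x', x'⁻¹})) :
    y ∈ Algebra.adjoin k ((B : Set F) ∪ {x, x'}) := by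
  have hx0 : x ≠ 0 := by
    rintro rfl
    exact hx isAlgebraic_zero
  have hB : ∀ z ∈ B, z ∈ Algebra.adjoin k ((B : Set F) ∪ {x, x'}) :=
    fun z hz => Algebra.subset_adjoin (Or.inl hz)
  have hxm : x ∈ Algebra.adjoin k ((B : Set F) ∪ {x, x'}) :=
    Algebra.subset_adjoin (Or.inr (Or.inl rfl))
  have hxm' : x' ∈ Algebra.adjoin k ((B : Set F) ∪ {x, x'}) :=
    Algebra.subset_adjoin (Or.inr (Or.inr rfl))
  obtain ⟨n, f, hf⟩ := exists_pow_mul_eq_aeval hx0 h1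
  clear h1
  induction n generalizing y f with
  | zero =>
    rw [pow_zero, one_mul] at hf
    rw [hf, Polynomial.aeval_eq_sum_range]
    exact sum_mem fun i _ => mul_mem (hB _ (f.coeff i).2) (pow_mem hxm i)
  | succ n ih =>
    obtain ⟨m, g, hg⟩ := exists_pow_mul_eq_aeval hx' h2
    set P : B := ⟨x * x', hP⟩ with hPdef
    have hP0 : P ≠ 0 := fun h => mul_ne_zero hx0 hx' (congrArg Subtype.val h)
    set K := g.natDegree
    -- Both expansions of `y` are written as polynomials in `x`, with `x'` eliminated by `x * x' =
    -- P`; transcendence of `x` then allows coefficients to be compared.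
    have hpoly : Polynomial.C (P ^ m) * Polynomial.X ^ K * f =
        ∑ l ∈ Finset.range (K + 1), Polynomial.C (g.coeff l * P ^ l) *
          Polynomial.X ^ (K + m + n + 1 - l) := by
      rw [transcendental_iff_injective] at hx
      apply hx
      simp only [map_mul, map_pow, map_sum, Polynomial.aeval_X, ← hf, Polynomial.aeval_C]
      have e1 : (algebraMap B F) P = x * x' := rfl
      have e2 : (x * x') ^ m * x ^ K * (x ^ (n + 1) * y) =
        x ^ (K + m + n + 1) * (x' ^ m * y) := by ring
      rw [e1, e2, hg, Polynomial.aeval_eq_sum_range, Finset.mul_sum]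
      refine Finset.sum_congr rfl fun l hl => ?_
      have hl' : l ≤ K + m + n + 1 := by
        have := Finset.mem_range.1 hl
        omega
      have e3 : x ^ (K + m + n + 1) = x ^ (K + m + n + 1 - l) * x ^ l := by
        rw [← pow_add, Nat.sub_add_cancel hl']
      rw [e3, Algebra.smul_def]
      ring
    -- On the right, only `l = m + n + 1` contributes to degree `K`; when this exceeds `K`, both
    -- sides vanish.
    have hcoeff : P ^ m * f.coeff 0 = g.coeff (m + n + 1) * P ^ (m + n + 1) := by
      have h := congrArg (fun q => Polynomial.coeff q K) hpoly
      have e1 : (Polynomial.C (P ^ m) * Polynomial.X ^ K * f).coeff K = P ^ m * f.coeff 0 := by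
        rw [mul_assoc, Polynomial.coeff_C_mul, Polynomial.coeff_X_pow_mul']
        simp
      simp only [e1, Polynomial.finsetSum_coeff, Polynomial.coeff_C_mul_X_pow] at h
      rw [h]
      by_cases hm : m + n + 1 ≤ K
      · rw [Finset.sum_eq_single (m + n + 1)]
        · rw [if_pos (by omega)]
        · intro l hl hne
          have := Finset.mem_range.1 hl
          rw [if_neg (by omega)]
        · intro h
          exact absurd (Finset.mem_range.2 (by omega)) h
      · rw [Finset.sum_eq_zero, Polynomial.coeff_eq_zero_of_natDegree_lt (by omega), zero_mul]
        intro l hl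
        have := Finset.mem_range.1 hl
        rw [if_neg (by omega)]
    have hf0 : f.coeff 0 = g.coeff (m + n + 1) * P ^ (n + 1) := by
      apply mul_left_cancel₀ (pow_ne_zero m hP0)
      rw [hcoeff]; ring
    set c := g.coeff (m + n + 1)
    -- As `x ^ (n + 1) * (c * x' ^ (n + 1))` is the constant term of `f`, subtracting `c * x' ^ (n +
    -- 1)` from `y` lowers the pole order in `x` by one.
    have key := ih (y := y - c * x' ^ (n + 1)) ?_ f.divX ?_
    · have := add_mem key (mul_mem (hB c c.2) (pow_mem hxm' (n + 1)))
      simpa using this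
    · exact sub_mem h2 (mul_mem (Algebra.subset_adjoin (Or.inl c.2))
        (pow_mem (M := F) (Algebra.subset_adjoin (Or.inr (Or.inl rfl))) _))
    · apply mul_left_cancel₀ hx0
      have h3 : Polynomial.aeval x f = x * Polynomial.aeval x f.divX + f.coeff 0 := by
        conv_lhs => rw [← Polynomial.X_mul_divX_add f]
        rw [map_add, map_mul, Polynomial.aeval_X, Polynomial.aeval_C]
        rfl
      have h4 : (f.coeff 0 : F) = c * (x * x') ^ (n + 1) := by
        rw [hf0]; simp [hPdef]
      linear_combination hf + h3 + h4

end OneVariable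

/-! ### Exchange polynomials and Laurent rings of adjacent seeds. -/

namespace Seed

variable {k F ι : Type*} [Field k] [Field F] [Algebra k F]

/-- The bound is by a field because the coefficient rings used with this lemma contain inverses of
the other variables. -/
theorem transcendental (s : Seed k F ι) (i : ι) {B : Subalgebra k F}
    (hB : B ≤ (IntermediateField.adjoin k (s.x '' {i}ᶜ)).toSubalgebra) :
    Transcendental B (s.x i) := by
  have h1 : Transcendental (Algebra.adjoin k (s.x '' {i}ᶜ)) (s.x i) :=
    s.algebraicIndependent.transcendental_adjoin (by simp)
  rw [← IntermediateField.transcendental_adjoin_iff] at h1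
  exact Transcendental.of_tower_top_of_subalgebra_le
    (B := (IntermediateField.adjoin k (s.x '' {i}ᶜ)).toSubalgebra) hB h1

theorem laurentOn_compl_le_adjoin (s : Seed k F ι) (i : ι) :
    laurentOn k s.x {i}ᶜ ≤ (IntermediateField.adjoin k (s.x '' {i}ᶜ)).toSubalgebra :=
  laurentOn_le fun l hl =>
    have : s.x l ∈ IntermediateField.adjoin k (s.x '' {i}ᶜ) :=
      IntermediateField.subset_adjoin _ _ ⟨l, hl, rfl⟩
    ⟨this, inv_mem (S := IntermediateField k F) this⟩

variable [Fintype ι]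

/-- The Laurent monomial with exponents the signed numbers of arrows into `j`. -/
def yhat (s : Seed k F ι) (j : ι) : F := ∏ l, s.x l ^ s.quiver.signed l j

/-- The monomial factor is a unit of the Laurent ring, so there divisibility by the exchange
polynomial is divisibility by `1 + s.yhat j`. -/
theorem exchangePoly_eq (s : Seed k F ι) (j : ι) :
    s.exchangePoly j = (∏ l, s.x l ^ s.quiver.arrows j l) * (1 + s.yhat j) := by
  rw [mul_add, mul_one, yhat, ← Finset.prod_mul_distrib, exchangePoly, add_comm]
  congr 1
  refine Finset.prod_congr rfl fun l _ => ?_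
  rw [← zpow_natCast, ← zpow_natCast, ← zpow_add₀ (s.x_ne_zero l)]
  simp [ClusterQuiver.signed]

theorem prod_pow_ne_zero (s : Seed k F ι) (a : ι → ℕ) : ∏ l, s.x l ^ a l ≠ 0 :=
  Finset.prod_ne_zero_iff.2 fun l _ => pow_ne_zero _ (s.x_ne_zero l)

theorem exchangePoly_mem_laurentOn (s : Seed k F ι) (j : ι) :
    s.exchangePoly j ∈ laurentOn k s.x {j}ᶜ :=
  add_mem (prod_pow_mem_laurentOn _ (by simp [s.quiver.no_loop]))
    (prod_pow_mem_laurentOn _ (by simp [s.quiver.no_loop]))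

variable [DecidableEq ι]

/-- The arrows created by the mutation contribute a monomial that cancels the monomial factor of
`s.exchangePoly i ^ b`, leaving the power of `1 + s.yhat i`. -/
theorem yhat_mutate (s : Seed k F ι) {i j : ι} (hi : i ∉ s.frozen) (hij : i ≠ j)
    (h : s.quiver.arrows i j = 0) :
    (s.mutate i hi).yhat j = s.yhat j * (1 + s.yhat i) ^ s.quiver.arrows j i := by
  set b := s.quiver.arrows j i with hb
  have hterm : ∀ l, (s.mutate i hi).x l ^ (s.mutate i hi).quiver.signed l j =
      s.x l ^ s.quiver.signed l j * ((s.x l ^ s.quiver.arrows i l) ^ b)⁻¹ *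
        (if l = i then s.exchangePoly i ^ b else 1) := by
    intro l
    have hl := s.x_ne_zero l
    change _ ^ (s.quiver.mutate i).signed l j = _
    by_cases hli : l = i
    · subst hli
      rw [mutate_x_self, ClusterQuiver.signed_mutate_left, s.quiver.no_loop]
      have : s.quiver.signed l j = -(b : ℤ) := by simp [ClusterQuiver.signed, h, hb]
      simp only [this, neg_neg, zpow_natCast, zpow_neg, mul_pow, inv_pow, if_true]
      simp [mul_comm]
    · rw [mutate_x_of_ne _ hi hli, ClusterQuiver.signed_mutate_of_ne _ hli hij.symm, h, ← hb]
      rw [if_neg hli, mul_one, ← pow_mul, ← zpow_natCast, ← zpow_neg, ← zpow_add₀ hl]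
      congr 1
      push_cast
      ring
  rw [yhat, Finset.prod_congr rfl fun l _ => hterm l, Finset.prod_mul_distrib,
    Finset.prod_mul_distrib, Finset.prod_ite_eq' _ _ (fun _ => s.exchangePoly i ^ b),
    Finset.prod_inv_distrib, Finset.prod_pow, if_pos (Finset.mem_univ i), exchangePoly_eq, mul_pow,
    ← yhat]
  have := s.prod_pow_ne_zero (s.quiver.arrows i)
  field_simp

/-- The Laurent polynomial ring of a seed. -/
def laurent (s : Seed k F ι) : Subalgebra k F := laurentOn k s.x Set.univ

omit [Fintype ι] [DecidableEq ι] in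
theorem x_mem_laurent (s : Seed k F ι) (i : ι) : s.x i ∈ s.laurent := mem_laurentOn trivial

omit [Fintype ι] [DecidableEq ι] in
theorem inv_x_mem_laurent (s : Seed k F ι) (i : ι) : (s.x i)⁻¹ ∈ s.laurent :=
  inv_mem_laurentOn trivial

omit [Fintype ι] [DecidableEq ι] in
theorem laurent_le_adjoin (s : Seed k F ι) (i : ι) :
    s.laurent ≤ Algebra.adjoin k ((laurentOn k s.x {i}ᶜ : Set F) ∪ {s.x i, (s.x i)⁻¹}) := by
  refine laurentOn_le fun l _ => ?_
  by_cases h : l = i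
  · subst h
    exact ⟨Algebra.subset_adjoin (by simp), Algebra.subset_adjoin (by simp)⟩
  · exact ⟨Algebra.subset_adjoin (Or.inl (mem_laurentOn (by simpa using h))),
      Algebra.subset_adjoin (Or.inl (inv_mem_laurentOn (by simpa using h)))⟩

theorem laurentOn_mutate (s : Seed k F ι) {j : ι} (hj : j ∉ s.frozen) {V : Set ι} (hV : j ∉ V) :
    laurentOn k (s.mutate j hj).x V = laurentOn k s.x V := by
  have : ∀ i ∈ V, (s.mutate j hj).x i = s.x i := fun i hi =>
    mutate_x_of_ne s hj (by rintro rfl; exact hV hi)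
  apply le_antisymm
  · exact laurentOn_le fun i hi => by
      rw [this i hi]; exact ⟨mem_laurentOn hi, inv_mem_laurentOn hi⟩
  · exact laurentOn_le fun i hi => by
      rw [← this i hi]; exact ⟨mem_laurentOn hi, inv_mem_laurentOn hi⟩

omit [Fintype ι] [DecidableEq ι] in
theorem laurentOn_le_laurent (s : Seed k F ι) (V : Set ι) : laurentOn k s.x V ≤ s.laurent :=
  laurentOn_le fun i _ => ⟨s.x_mem_laurent i, s.inv_x_mem_laurent i⟩

theorem laurentOn_le_laurent_mutate (s : Seed k F ι) {j : ι} (hj : j ∉ s.frozen) {V : Set ι}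
    (hV : j ∉ V) : laurentOn k s.x V ≤ (s.mutate j hj).laurent := by
  rw [← laurentOn_mutate s hj hV]
  exact laurentOn_le_laurent _ _

theorem x_mem_laurent_mutate (s : Seed k F ι) {j : ι} (hj : j ∉ s.frozen) (i : ι) :
    s.x i ∈ (s.mutate j hj).laurent := by
  by_cases h : i = j
  · subst h
    have h1 := s.x_mul_mutate_x hj
    have h2 := (s.mutate i hj).x_ne_zero i
    rw [← eq_div_iff h2, div_eq_mul_inv] at h1
    rw [h1]
    exact mul_mem (s.laurentOn_le_laurent_mutate hj (by simp) (s.exchangePoly_mem_laurentOn i))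
      (inv_x_mem_laurent _ _)
  · rw [← mutate_x_of_ne s hj h]
    exact x_mem_laurent _ _

theorem mem_adjoin_of_mem_laurent (s : Seed k F ι) {i : ι} (hi : i ∉ s.frozen) {y : F}
    (h : y ∈ s.laurent) (h' : y ∈ (s.mutate i hi).laurent) :
    y ∈ Algebra.adjoin k
      ((laurentOn k s.x {i}ᶜ : Set F) ∪ {s.x i, (s.mutate i hi).x i}) := by
  refine mem_adjoin_pair_of_mem_laurent (s.transcendental i (s.laurentOn_compl_le_adjoin i))
    (x_ne_zero _ _) ?_ (s.laurent_le_adjoin i h) ?_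
  · rw [x_mul_mutate_x]
    exact s.exchangePoly_mem_laurentOn i
  · rw [← laurentOn_mutate s hi (by simp)]
    exact (s.mutate i hi).laurent_le_adjoin i h'

end Seed

/-! ### Rank two step for two joined vertices. -/

namespace Seed

variable {k F ι : Type*} [Field k] [Field F] [Algebra k F] [Fintype ι] [DecidableEq ι]

theorem exists_one_add_pow_eq {A : Subalgebra k F} {z : F} (hz : z ∈ A) (n : ℕ) :
    ∃ c ∈ A, (1 + z) ^ n = 1 + z * c := by
  obtain ⟨c, hc⟩ := sub_dvd_pow_sub_pow (1 + ⟨z, hz⟩ : A) 1 n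
  refine ⟨c, c.2, ?_⟩
  have := congrArg Subtype.val hc
  push_cast at this
  linear_combination this

/-- The variables in the cluster of `μ_j μ_i s` are Laurent polynomials in that of `μ_j s`. -/
theorem mutate_mutate_x_mem_laurent (s : Seed k F ι) {i j : ι} (hi : i ∉ s.frozen)
    (hj : j ∉ s.frozen) (hij : i ≠ j) (h0 : s.quiver.arrows i j = 0)
    (hpos : 0 < s.quiver.arrows j i) :
    ((s.mutate i hi).mutate j (s.notMem_frozen_mutate hj hi)).x j ∈ (s.mutate j hj).laurent := by
  set C := (s.mutate j hj).laurent
  set b := s.quiver.arrows j i with hb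
  have hle : ∀ {z}, z ∈ laurentOn k s.x {j}ᶜ → z ∈ C :=
    fun hz => s.laurentOn_le_laurent_mutate hj (by simp) hz
  have hx : ∀ l, s.x l ∈ C := s.x_mem_laurent_mutate hj
  have hxj := s.x_ne_zero j
  -- the monomial factors
  have hJ : (∏ l, (s.mutate i hi).x l ^ (s.mutate i hi).quiver.arrows j l) ∈ C := by
    have h1 : (s.mutate i hi).quiver.arrows j i = 0 :=
      (s.quiver.arrows_mutate_right i j).trans h0
    rw [prod_mutate_x s hi h1]
    exact hle (prod_pow_mem_laurentOn _ (by
      have : (s.mutate i hi).quiver.arrows j j = 0 := (s.mutate i hi).quiver.no_loop j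
      simp [this]))
  have hJ' : (∏ l, s.x l ^ s.quiver.arrows j l)⁻¹ ∈ C :=
    hle (inv_prod_pow_mem_laurentOn _ (by simp [s.quiver.no_loop]))
  have hyj : s.yhat j ∈ C :=
    hle (prod_zpow_mem_laurentOn _ (by simp [s.quiver.signed_self]))
  set m := ∏ l, s.x l ^ (if l = j then 0 else s.quiver.signed l i) with hm
  have hmC : m ∈ C := hle (prod_zpow_mem_laurentOn _ (by simp))
  have hyi : s.yhat i = s.x j ^ b * m := by
    rw [yhat, hm, ← Finset.mul_prod_erase _ _ (Finset.mem_univ j),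
      ← Finset.mul_prod_erase Finset.univ (fun l => s.x l ^ (if l = j then 0 else _))
        (Finset.mem_univ j)]
    have h1 : s.quiver.signed j i = b := by simp [ClusterQuiver.signed, h0, hb]
    rw [h1, if_pos rfl, zpow_zero, one_mul, zpow_natCast]
    congr 1
    exact Finset.prod_congr rfl fun l hl => by rw [if_neg (Finset.ne_of_mem_erase hl)]
  have hyiC : s.yhat i ∈ C := hyi ▸ mul_mem (pow_mem (hx j) _) hmC
  obtain ⟨c, hc, hpow⟩ := exists_one_add_pow_eq hyiC b
  have h1 : (1 + s.yhat j) * (s.x j)⁻¹ ∈ C := by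
    have : (1 + s.yhat j) * (s.x j)⁻¹ =
        (∏ l, s.x l ^ s.quiver.arrows j l)⁻¹ * (s.mutate j hj).x j := by
      rw [mutate_x_self, exchangePoly_eq]
      have := s.prod_pow_ne_zero (s.quiver.arrows j)
      field_simp
    rw [this]
    exact mul_mem hJ' (x_mem_laurent _ _)
  have h2 : s.yhat i * (s.x j)⁻¹ ∈ C := by
    have : s.yhat i * (s.x j)⁻¹ = s.x j ^ (b - 1) * m := by
      rw [hyi]
      obtain ⟨d, hd⟩ := Nat.exists_eq_add_of_le' hpos
      rw [hd, Nat.add_sub_cancel, pow_succ]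
      field_simp
    rw [this]
    exact mul_mem (pow_mem (hx j) _) hmC
  -- The exchange polynomial is now a monomial times `1 + ŷ j * (1 + ŷ i) ^ b`. Modulo `ŷ i` this is
  -- `1 + ŷ j`, which over `x j` is a unit times the variable of `μ_j s`; the rest is divisible by
  -- `x j` because `ŷ i` contains `x j ^ b` with `b > 0`.
  rw [mutate_x_self, mutate_x_of_ne s hi hij.symm, exchangePoly_eq, yhat_mutate s hi hij h0, hpow]
  have : ∀ J : F, J * (1 + s.yhat j * (1 + s.yhat i * c)) * (s.x j)⁻¹ =
      J * ((1 + s.yhat j) * (s.x j)⁻¹ + s.yhat j * (s.yhat i * (s.x j)⁻¹) * c) := by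
    intro J; ring
  rw [this]
  exact mul_mem hJ (add_mem h1 (mul_mem (mul_mem hyj h2) hc))

omit [Fintype ι] in
theorem exists_pow_mul_mem_of_mem_laurentOn {A : Subalgebra k F} {x : ι → F} {V : Set ι} {j : ι}
    (hx0 : x j ≠ 0) (hxj : x j ∈ A) (hA : ∀ i ∈ V, i ≠ j → x i ∈ A ∧ (x i)⁻¹ ∈ A) {y : F}
    (hy : y ∈ laurentOn k x V) : ∃ n : ℕ, x j ^ n * y ∈ A := by
  refine exists_pow_mul_mem_of_mem_adjoin hxj ?_ hy
  rintro _ ⟨l, hl, hz⟩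
  by_cases h : l = j
  · subst h
    obtain rfl | rfl := hz
    · exact ⟨0, by simpa using hxj⟩
    · exact ⟨1, by simp [hx0, one_mem]⟩
  · obtain rfl | rfl := hz
    · exact ⟨0, by simpa using (hA l hl h).1⟩
    · exact ⟨0, by simpa using (hA l hl h).2⟩

/-- The rank two step when `i` and `j` are joined by arrows `j → i`. -/
theorem mem_laurent_mutate_of_arrows (s : Seed k F ι) {i j : ι} (hi : i ∉ s.frozen)
    (hj : j ∉ s.frozen) (hij : i ≠ j) (h0 : s.quiver.arrows i j = 0)
    (hpos : 0 < s.quiver.arrows j i) {y : F} (hy : y ∈ s.laurent)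
    (hy1 : y ∈ (s.mutate i hi).laurent)
    (hy2 : y ∈ ((s.mutate i hi).mutate j (s.notMem_frozen_mutate hj hi)).laurent) :
    y ∈ (s.mutate j hj).laurent := by
  have hx2 := s.mutate_mutate_x_mem_laurent hi hj hij h0 hpos
  set C := (s.mutate j hj).laurent
  set s1 := s.mutate i hi with hs1
  set s2 := s1.mutate j (s.notMem_frozen_mutate hj hi) with hs2
  -- `L` lies in the target Laurent ring. The edge from `s` to `s1` puts `y` into `L[(x j)⁻¹]`, the
  -- edge from `s1` to `s2` puts it into the localization of `L` at the new variable at `i`, and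
  -- these two elements are comaximal in `L`.
  set L : Subalgebra k F := Algebra.adjoin k ((laurentOn k s.x {i, j}ᶜ : Set F) ∪
    {s.x i, s1.x i, s.x j, s2.x j}) with hL
  have hxij : ∀ l, l ≠ i → l ≠ j → s.x l ∈ L ∧ (s.x l)⁻¹ ∈ L := fun l h1 h2 =>
    ⟨Algebra.subset_adjoin (Or.inl (mem_laurentOn (by simp [h1, h2]))),
      Algebra.subset_adjoin (Or.inl (inv_mem_laurentOn (by simp [h1, h2])))⟩
  have hxi : s.x i ∈ L := Algebra.subset_adjoin (Or.inr (by simp))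
  have hxi1 : s1.x i ∈ L := Algebra.subset_adjoin (Or.inr (by simp))
  have hxj : s.x j ∈ L := Algebra.subset_adjoin (Or.inr (by simp))
  have hxj2 : s2.x j ∈ L := Algebra.subset_adjoin (Or.inr (by simp))
  have hs1j : s1.x j = s.x j := mutate_x_of_ne s hi hij.symm
  have hs1l : ∀ l, l ≠ i → s1.x l = s.x l := fun l hl => mutate_x_of_ne s hi hl
  have hs1L : ∀ l, s1.x l ∈ L := by
    intro l
    by_cases h1 : l = i
    · rwa [h1]
    rw [hs1l l h1]
    by_cases h2 : l = j
    · rwa [h2]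
    exact (hxij l h1 h2).1
  have hLC : L ≤ C := by
    refine Algebra.adjoin_le ?_
    rintro z (hz | rfl | rfl | rfl | rfl)
    · exact s.laurentOn_le_laurent_mutate hj (by simp) hz
    · exact s.x_mem_laurent_mutate hj i
    · rw [hs1, mutate_x_self]
      refine mul_mem (add_mem ?_ ?_) (s.laurentOn_le_laurent_mutate hj (V := {j}ᶜ) (by simp)
        (inv_mem_laurentOn (by simpa using hij)))
      · exact prod_mem fun l _ => pow_mem (s.x_mem_laurent_mutate hj l) _
      · exact prod_mem fun l _ => pow_mem (s.x_mem_laurent_mutate hj l) _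
    · exact s.x_mem_laurent_mutate hj j
    · exact hx2
  apply hLC
  -- `y` lies in the localization of `L` at `x j`
  have hm : ∃ m : ℕ, s.x j ^ m * y ∈ L := by
    refine exists_pow_mul_mem_of_mem_adjoin hxj ?_ (s.mem_adjoin_of_mem_laurent hi hy hy1)
    rintro z (hz | rfl | rfl)
    · exact exists_pow_mul_mem_of_mem_laurentOn (s.x_ne_zero j) hxj
        (fun l h1 h2 => hxij l h1 h2) hz
    · exact ⟨0, by simpa using hxi⟩
    · exact ⟨0, by simpa using hxi1⟩
  -- `y` lies in the localization of `L` at the mutated variable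
  have hn : ∃ n : ℕ, s1.x i ^ n * y ∈ L := by
    refine exists_pow_mul_mem_of_mem_adjoin hxi1 ?_ (s1.mem_adjoin_of_mem_laurent
      (s.notMem_frozen_mutate hj hi) hy1 hy2)
    rintro z (hz | rfl | rfl)
    · refine exists_pow_mul_mem_of_mem_laurentOn (s1.x_ne_zero i) hxi1 (fun l h1 h2 => ?_) hz
      rw [hs1l l h2]
      exact hxij l h2 h1
    · exact ⟨0, by simpa using hs1L j⟩
    · exact ⟨0, by simpa using hxj2⟩
  obtain ⟨m, hm⟩ := hm
  obtain ⟨n, hn⟩ := hn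
  have ha1 : s1.quiver.arrows i j = s.quiver.arrows j i := s.quiver.arrows_mutate_left i j
  have ha2 : s1.quiver.arrows j i = 0 := (s.quiver.arrows_mutate_right i j).trans h0
  have hprod : s.x j * s2.x j = s1.exchangePoly j := by
    rw [← hs1j]; exact s1.x_mul_mutate_x _
  set u := ∏ l, s1.x l ^ s1.quiver.arrows j l with hu
  have huL : u⁻¹ ∈ L := by
    rw [hu, hs1, prod_mutate_x s hi ha2]
    refine Algebra.subset_adjoin (Or.inl (inv_prod_pow_mem_laurentOn _ fun l hl => ?_))
    have : l = i ∨ l = j := by simpa [or_iff_not_imp_left] using hl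
    obtain rfl | rfl := this
    · exact ha2
    · exact s1.quiver.no_loop l
  set a := s1.x i ^ (s1.quiver.arrows i j - 1) *
    ∏ l ∈ Finset.univ.erase i, s1.x l ^ s1.quiver.arrows l j with ha
  have haL : a ∈ L := mul_mem (pow_mem (hs1L i) _) (prod_mem fun l _ => pow_mem (hs1L l) _)
  have hsplit : ∏ l, s1.x l ^ s1.quiver.arrows l j = s1.x i * a := by
    rw [← Finset.mul_prod_erase _ _ (Finset.mem_univ i), ha, ← mul_assoc, ← pow_succ',
      Nat.sub_add_cancel (by omega)]
  -- Comaximality is the exchange relation for `s2.x j`: one of its monomials is divisible by `s1.x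
  -- i`, and the other, `u`, involves neither `i` nor `j` and is a unit of `L`.
  refine mem_of_pow_mul_mem hxj hxi1 hxj2 (neg_mem haL) huL (s1.prod_pow_ne_zero _) ?_ hm hn
  rw [hprod, exchangePoly, hsplit]
  ring

theorem arrows_mutate_of_isolated (s : Seed k F ι) {i j : ι} (hi : i ∉ s.frozen)
    (hij : i ≠ j) (h0 : s.quiver.arrows i j = 0) (h1 : s.quiver.arrows j i = 0) (l : ι) :
    (s.mutate i hi).quiver.arrows l j = s.quiver.arrows l j ∧
      (s.mutate i hi).quiver.arrows j l = s.quiver.arrows j l := by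
  change (s.quiver.mutate i).arrows l j = _ ∧ (s.quiver.mutate i).arrows j l = _
  by_cases hl : l = i
  · subst hl
    rw [ClusterQuiver.arrows_mutate_left, ClusterQuiver.arrows_mutate_right, h0, h1]
    simp
  · simp only [ClusterQuiver.arrows_eq_toNat (s.quiver.mutate i)]
    rw [ClusterQuiver.signed_mutate_of_ne _ hl hij.symm,
      ClusterQuiver.signed_mutate_of_ne _ hij.symm hl, h0, h1]
    simp [← ClusterQuiver.arrows_eq_toNat]

theorem exchangePoly_mutate_of_isolated (s : Seed k F ι) {i j : ι} (hi : i ∉ s.frozen)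
    (hij : i ≠ j) (h0 : s.quiver.arrows i j = 0) (h1 : s.quiver.arrows j i = 0) :
    (s.mutate i hi).exchangePoly j = s.exchangePoly j := by
  have h := s.arrows_mutate_of_isolated hi hij h0 h1
  simp only [exchangePoly, fun l => (h l).1, fun l => (h l).2]
  rw [prod_mutate_x s hi (a := fun l => s.quiver.arrows l j) h0,
    prod_mutate_x s hi (a := s.quiver.arrows j) h1]

end Seed

/-! ### Rank two step for unjoined vertices, upper bounds, and the Laurent phenomenon in full rank.
-/

namespace Seed

variable {k F ι : Type*} [Field k] [Field F] [Algebra k F] [Fintype ι] [DecidableEq ι]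

omit [DecidableEq ι] in
-- Full rank gives a nonzero 2×2 minor of the columns at `i` and `j`. Expanding that minor along its
-- second column gives a form that kills the first column and is nonzero on the second; its sign can
-- be chosen.
theorem FullRank.exists_linearForm {s : Seed k F ι} (h : s.FullRank) {i j : ι} (hi : i ∉ s.frozen)
    (hj : j ∉ s.frozen) (hij : i ≠ j) : ∃ l : (ι → ℤ) →+ ℤ,
      l (fun m => s.quiver.signed m i) = 0 ∧ 0 < l (fun m => s.quiver.signed m j) := by
  classical
  set u : ι → ℤ := fun m => s.quiver.signed m i with hu
  set v : ι → ℤ := fun m => s.quiver.signed m j with hv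
  have key : ∃ a b, u a * v b - u b * v a ≠ 0 := by
    by_contra! hcon
    have hcomb : ∀ c d : ℤ, (∀ m, u m * c + v m * d = 0) → c = 0 ∧ d = 0 := by
      intro c d hcd
      have h0 := h (fun m => if m = i then c else if m = j then d else 0) ?_ ?_
      · exact ⟨by simpa using congrFun h0 i, by simpa [hij.symm] using congrFun h0 j⟩
      · intro m hm
        have h1 : m ≠ i := by rintro rfl; exact hi hm
        have h2 : m ≠ j := by rintro rfl; exact hj hm
        simp [h1, h2]
      · intro m
        rw [Finset.sum_eq_add i j hij]
        · simpa [hij.symm] using hcd m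
        · rintro l - ⟨h1, h2⟩
          simp [h1, h2]
        · simp
        · simp
    have hu0 : ∀ m, u m = 0 := fun m => by
      have := (hcomb (v m) (-u m) fun l => by linarith [hcon l m]).2
      omega
    have := (hcomb 1 0 fun m => by simp [hu0]).1
    exact one_ne_zero this
  obtain ⟨a, b, hab⟩ := key
  let l : (ι → ℤ) →+ ℤ := AddMonoidHom.mk' (fun w => u a * w b - u b * w a) fun w w' => by
    simp only [Pi.add_apply]; ring
  have hlu : l u = 0 := by simp only [l, AddMonoidHom.mk'_apply]; ring
  have hlv : l v ≠ 0 := hab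
  rcases lt_or_gt_of_ne hlv with hneg | hpos
  · exact ⟨-l, by simp [hlu], by simpa using hneg⟩
  · exact ⟨l, hlu, hpos⟩

omit [DecidableEq ι] in
-- The two exchange polynomials are coprime up to units, by `one_add_single_dvd_of_dvd_mul`, so an
-- element whose products with both are Laurent is itself Laurent.
theorem mem_laurent_of_mul_mem (s : Seed k F ι) (h : s.FullRank) {i j : ι} (hi : i ∉ s.frozen)
    (hj : j ∉ s.frozen) (hij : i ≠ j) {z : F} (h1 : s.exchangePoly i * z ∈ s.laurent)
    (h2 : s.exchangePoly j * z ∈ s.laurent) : z ∈ s.laurent := by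
  obtain ⟨l, hu, hv⟩ := h.exists_linearForm hi hj hij
  have hunit : ∀ m, s.exchangePoly m * z ∈ s.laurent → (1 + s.yhat m) * z ∈ s.laurent := by
    intro m hm
    have : (1 + s.yhat m) * z =
        (∏ l, s.x l ^ s.quiver.arrows m l)⁻¹ * (s.exchangePoly m * z) := by
      rw [exchangePoly_eq]
      have := s.prod_pow_ne_zero (s.quiver.arrows m)
      field_simp
    rw [this]
    exact mul_mem (inv_prod_pow_mem_laurentOn _ (by simp)) hm
  replace h1 := hunit i h1
  replace h2 := hunit j h2
  have hev : ∀ m, laurentEval k s.x s.x_ne_zero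
      (1 + AddMonoidAlgebra.single (fun l => s.quiver.signed l m) 1) = 1 + s.yhat m := by
    intro m
    rw [map_add, map_one, laurentEval_single, map_one, one_mul, yhat]
  have hinj := laurentEval_injective s.x_ne_zero s.algebraicIndependent
  rw [laurent, ← range_laurentEval s.x_ne_zero] at h1 h2 ⊢
  obtain ⟨b, hb⟩ := h1
  obtain ⟨a, ha⟩ := h2
  change laurentEval k s.x s.x_ne_zero b = _ at hb
  change laurentEval k s.x s.x_ne_zero a = _ at ha
  obtain ⟨w, hw⟩ := one_add_single_dvd_of_dvd_mul l hu hv (a := a) (b := b) (hinj (by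
    rw [map_mul, map_mul, hev, hev, ha, hb]; ring))
  refine ⟨w, ?_⟩
  change laurentEval k s.x s.x_ne_zero w = _
  rw [hw, map_mul, hev] at hb
  have h0 : 1 + s.yhat i ≠ 0 := by
    have := s.exchangePoly_ne_zero hi
    rw [exchangePoly_eq] at this
    exact right_ne_zero_of_mul this
  exact mul_left_cancel₀ h0 hb

omit [DecidableEq ι] in
theorem mem_laurent_of_pow_mul_mem (s : Seed k F ι) (h : s.FullRank) {i j : ι} (hi : i ∉ s.frozen)
    (hj : j ∉ s.frozen) (hij : i ≠ j) {z : F} {m n : ℕ}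
    (h1 : s.exchangePoly i ^ m * z ∈ s.laurent)
    (h2 : s.exchangePoly j ^ n * z ∈ s.laurent) : z ∈ s.laurent := by
  have hP : ∀ l, s.exchangePoly l ∈ s.laurent := fun l =>
    s.laurentOn_le_laurent _ (s.exchangePoly_mem_laurentOn l)
  have aux : ∀ (n : ℕ) {z : F}, s.exchangePoly i * z ∈ s.laurent →
      s.exchangePoly j ^ n * z ∈ s.laurent → z ∈ s.laurent := by
    intro n
    induction n with
    | zero => intro z _ h; simpa using h
    | succ n ih =>
      intro z h1 h2
      refine ih h1 (s.mem_laurent_of_mul_mem h hi hj hij ?_ ?_)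
      · rw [mul_left_comm]; exact mul_mem (pow_mem (hP j) _) h1
      · rwa [← mul_assoc, ← pow_succ']
  induction m with
  | zero => simpa using h1
  | succ m ih =>
    refine ih (aux n ?_ ?_)
    · rwa [← mul_assoc, ← pow_succ']
    · rw [mul_left_comm]; exact mul_mem (pow_mem (hP i) _) h2

/-- The rank two step when `i` and `j` are not joined by an arrow. -/
theorem mem_laurent_mutate_of_isolated (s : Seed k F ι) (h : s.FullRank) {i j : ι}
    (hi : i ∉ s.frozen) (hj : j ∉ s.frozen) (hij : i ≠ j) (h0 : s.quiver.arrows i j = 0)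
    (h1 : s.quiver.arrows j i = 0) {y : F} (hy : y ∈ s.laurent)
    (hy2 : y ∈ ((s.mutate i hi).mutate j (s.notMem_frozen_mutate hj hi)).laurent) :
    y ∈ (s.mutate j hj).laurent := by
  set t := s.mutate j hj with ht
  have hPi : t.exchangePoly i = s.exchangePoly i :=
    s.exchangePoly_mutate_of_isolated hj hij.symm h1 h0
  have hPj : t.exchangePoly j = s.exchangePoly j := s.exchangePoly_mutate_self hj
  have hP : ∀ l, t.exchangePoly l ∈ t.laurent := fun l =>
    t.laurentOn_le_laurent _ (t.exchangePoly_mem_laurentOn l)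
  have htx : ∀ l, l ≠ j → t.x l = s.x l := fun l hl => mutate_x_of_ne s hj hl
  have hxt : ∀ l, s.x l ∈ t.laurent := s.x_mem_laurent_mutate hj
  have hxit : ∀ l, l ≠ j → (s.x l)⁻¹ ∈ t.laurent := fun l hl => by
    rw [← htx l hl]; exact t.inv_x_mem_laurent l
  -- The only generator of the Laurent ring of `s` that may be missing from that of `t` is `(s.x
  -- j)⁻¹`, which is `t.x j` divided by the exchange polynomial at `j`.
  have hn : ∃ n : ℕ, t.exchangePoly j ^ n * y ∈ t.laurent := by
    refine exists_pow_mul_mem_of_mem_adjoin (hP j) ?_ hy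
    rintro _ ⟨l, -, rfl | rfl⟩
    · exact ⟨0, by simpa using hxt l⟩
    · by_cases hl : l = j
      · subst hl
        refine ⟨1, ?_⟩
        rw [pow_one, hPj, ← mutate_x_self s hj]
        exact t.x_mem_laurent l
      · exact ⟨0, by simpa using hxit l hl⟩
  set s1 := s.mutate i hi with hs1
  set s2 := s1.mutate j (s.notMem_frozen_mutate hj hi) with hs2
  have hs2i : s2.x i = s.exchangePoly i * (s.x i)⁻¹ := by
    rw [hs2, mutate_x_of_ne s1 _ hij, hs1, mutate_x_self]
  have hs2j : s2.x j = t.x j := by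
    rw [hs2, mutate_x_self, hs1, mutate_x_of_ne s hi hij.symm,
      exchangePoly_mutate_of_isolated s hi hij h0 h1, ht, mutate_x_self]
  -- With `i` and `j` unjoined, the clusters of `s2` and `t` differ only at `i`, so here only the
  -- exchange polynomial at `i` is inverted.
  have hm : ∃ m : ℕ, t.exchangePoly i ^ m * y ∈ t.laurent := by
    refine exists_pow_mul_mem_of_mem_adjoin (hP i) ?_ hy2
    rintro _ ⟨l, -, hz⟩
    by_cases hl : l = j
    · subst hl
      rw [hs2j] at hz
      obtain rfl | rfl := hz
      · exact ⟨0, by simpa using t.x_mem_laurent l⟩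
      · exact ⟨0, by simpa using t.inv_x_mem_laurent l⟩
    by_cases hl' : l = i
    · subst hl'
      rw [hs2i] at hz
      obtain rfl | rfl := hz
      · exact ⟨0, by simpa [← hPi] using mul_mem (hP l) (hxit l hl)⟩
      · refine ⟨1, ?_⟩
        have := s.exchangePoly_ne_zero hi
        rw [pow_one, hPi, mul_inv, inv_inv, mul_inv_cancel_left₀ this]
        exact hxt l
    · have : s2.x l = s.x l := by
        rw [hs2, mutate_x_of_ne s1 _ hl, hs1, mutate_x_of_ne s _ hl']
      rw [this] at hz
      obtain rfl | rfl := hz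
      · exact ⟨0, by simpa using hxt l⟩
      · exact ⟨0, by simpa using hxit l hl⟩
  obtain ⟨m, hm⟩ := hm
  obtain ⟨n, hn⟩ := hn
  exact t.mem_laurent_of_pow_mul_mem (h.mutate hj) hi hj hij hm hn

theorem mem_laurent_mutate (s : Seed k F ι) (h : s.FullRank) {i j : ι}
    (hi : i ∉ s.frozen) (hj : j ∉ s.frozen) (hij : i ≠ j) {y : F} (hy : y ∈ s.laurent)
    (hy1 : y ∈ (s.mutate i hi).laurent)
    (hy2 : y ∈ ((s.mutate i hi).mutate j (s.notMem_frozen_mutate hj hi)).laurent) :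
    y ∈ (s.mutate j hj).laurent := by
  rcases Nat.eq_zero_or_pos (s.quiver.arrows i j) with h0 | h0
  · rcases Nat.eq_zero_or_pos (s.quiver.arrows j i) with h1 | h1
    · exact s.mem_laurent_mutate_of_isolated h hi hj hij h0 h1 hy hy2
    · exact s.mem_laurent_mutate_of_arrows hi hj hij h0 h1 hy hy1 hy2
  · have h1 := (s.quiver.no_two_cycle i j).resolve_left h0.ne'
    -- Reversing all arrows preserves clusters and exchange polynomials, which reduces the other
    -- orientation to the case already treated.
    have := s.op.mem_laurent_mutate_of_arrows hi hj hij h1 h0 (y := y) hy ?_ ?_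
    · rwa [op_mutate] at this
    · rwa [op_mutate]
    · have e : (s.op.mutate i hi).mutate j (s.op.notMem_frozen_mutate hj hi) =
          ((s.mutate i hi).mutate j (s.notMem_frozen_mutate hj hi)).op := by
        rw [← op_mutate]
        congr 1
        exact op_mutate s i hi
      rw [e]
      exact hy2

/-- The upper bound of a seed: elements that are Laurent polynomials in its cluster and in all
adjacent clusters. -/
def upperBound (s : Seed k F ι) : Set F :=
  {y | y ∈ s.laurent ∧ ∀ j (hj : j ∉ s.frozen), y ∈ (s.mutate j hj).laurent}

/-- An element of the upper bound of `μ_i s` is Laurent in `μ_i μ_i s = s`, in `μ_i s` and in `μ_j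
μ_i s`; the rank two step passes from these to `μ_j s`. -/
theorem upperBound_mutate_subset (s : Seed k F ι) (h : s.FullRank) {i : ι} (hi : i ∉ s.frozen) :
    (s.mutate i hi).upperBound ⊆ s.upperBound := by
  rintro y ⟨h1, h2⟩
  have hs : y ∈ s.laurent := by
    have := h2 i (s.notMem_frozen_mutate hi hi)
    rwa [mutate_mutate] at this
  refine ⟨hs, fun j hj => ?_⟩
  by_cases hij : i = j
  · subst hij; exact h1
  · exact s.mem_laurent_mutate h hi hj hij hs h1 (h2 j _)

theorem upperBound_subset (s : Seed k F ι) (h : s.FullRank) {t : Seed k F ι}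
    (hst : s.MutationEquiv t) : t.upperBound ⊆ s.upperBound := by
  induction hst with
  | refl => exact subset_rfl
  | tail hst' h' ih =>
    obtain ⟨j, hj, rfl⟩ := h'
    exact (upperBound_mutate_subset _ (h.mutationEquiv hst') hj).trans ih

/-- The Laurent phenomenon for seeds of full rank. -/
theorem x_mem_laurent_of_fullRank (s : Seed k F ι) (h : s.FullRank) {t : Seed k F ι}
    (hst : s.MutationEquiv t) (i : ι) : t.x i ∈ s.laurent :=
  (s.upperBound_subset h hst ⟨t.x_mem_laurent i, fun _ hj => t.x_mem_laurent_mutate hj i⟩).1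

end Seed

/-! ### Principal coefficients and the Laurent phenomenon in general. -/

namespace Seed

variable {k F ι : Type*} [Field k] [Field F] [Algebra k F]

theorem adjoin_range_X_fractionRing (k σ : Type*) [Field k] :
    IntermediateField.adjoin k (Set.range fun i : σ =>
      algebraMap (MvPolynomial σ k) (FractionRing (MvPolynomial σ k)) (MvPolynomial.X i)) = ⊤ := by
  set K := IntermediateField.adjoin k (Set.range fun i : σ =>
      algebraMap (MvPolynomial σ k) (FractionRing (MvPolynomial σ k)) (MvPolynomial.X i))
  have h : ∀ p : MvPolynomial σ k, algebraMap _ (FractionRing (MvPolynomial σ k)) p ∈ K := by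
    intro p
    induction p using MvPolynomial.induction_on with
    | C a =>
      rw [← MvPolynomial.algebraMap_eq, ← IsScalarTower.algebraMap_apply]
      exact K.algebraMap_mem a
    | add p q hp hq => rw [map_add]; exact add_mem hp hq
    | mul_X p i hp =>
      rw [map_mul]
      exact mul_mem hp (IntermediateField.subset_adjoin _ _ ⟨i, rfl⟩)
  rw [eq_top_iff]
  intro z _
  obtain ⟨a, b, -, rfl⟩ := IsFractionRing.div_surjective (A := MvPolynomial σ k) z
  exact div_mem (h a) (h b)

variable [DecidableEq ι]

/-- The seed with principal coefficients: a frozen vertex with an arrow to `i` is added for each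
vertex `i`. -/
noncomputable def principal (s : Seed k F ι) :
    Seed k (FractionRing (MvPolynomial (ι ⊕ ι) k)) (ι ⊕ ι) where
  quiver :=
    { arrows := fun v w => Sum.elim (fun j => Sum.elim (fun i => s.quiver.arrows i j)
        (fun i => if i = j then 1 else 0) v) (fun _ => 0) w
      no_loop := by rintro (i | i) <;> simp [s.quiver.no_loop]
      no_two_cycle := by
        rintro (i | i) (j | j) <;> simp
        exact s.quiver.no_two_cycle i j }
  x v := algebraMap (MvPolynomial (ι ⊕ ι) k) _ (MvPolynomial.X v)
  frozen := {v | Sum.elim (fun i => i ∈ s.frozen) (fun _ => True) v}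
  algebraicIndependent := by
    have := (MvPolynomial.algebraicIndependent_X (ι ⊕ ι) k).map' (f := IsScalarTower.toAlgHom k
      (MvPolynomial (ι ⊕ ι) k) (FractionRing (MvPolynomial (ι ⊕ ι) k)))
      (IsFractionRing.injective (MvPolynomial (ι ⊕ ι) k) _)
    exact this
  adjoin_eq_top := adjoin_range_X_fractionRing k (ι ⊕ ι)
  touches := by
    rintro (i | i) hi
    · obtain ⟨j, hj⟩ := s.touches i hi
      exact ⟨Sum.inl j, hj⟩
    · exact absurd trivial hi

variable [Fintype ι]

/-- The row of the frozen vertex attached to `i` has a single nonzero entry, in the column of `i`.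
-/
theorem principal_fullRank (s : Seed k F ι) : s.principal.FullRank := by
  intro c hc0 hc
  have hr : ∀ i, c (Sum.inr i) = 0 := fun i => hc0 _ (by simp [principal])
  funext v
  rcases v with i | i
  · have := hc (Sum.inr i)
    rw [Fintype.sum_sum_type] at this
    simpa [ClusterQuiver.signed, principal, hr] using this
  · exact hr i

/-- `w` is the value of the Laurent polynomial `z` in the cluster of `s.principal` when the
coefficients are specialized to `1`. -/
def Specializes (s : Seed k F ι) (z : FractionRing (MvPolynomial (ι ⊕ ι) k)) (w : F) : Prop :=
  ∃ f, laurentEval k s.principal.x s.principal.x_ne_zero f = z ∧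
    laurentEval k (Sum.elim s.x fun _ : ι => 1) (by rintro (i | i) <;> simp [s.x_ne_zero]) f = w

namespace Specializes

variable {s : Seed k F ι} {z z' : FractionRing (MvPolynomial (ι ⊕ ι) k)} {w w' : F}

theorem add (h : s.Specializes z w) (h' : s.Specializes z' w') :
    s.Specializes (z + z') (w + w') := by
  obtain ⟨f, rfl, rfl⟩ := h
  obtain ⟨g, rfl, rfl⟩ := h'
  exact ⟨f + g, map_add _ _ _, map_add _ _ _⟩

theorem mul (h : s.Specializes z w) (h' : s.Specializes z' w') :
    s.Specializes (z * z') (w * w') := by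
  obtain ⟨f, rfl, rfl⟩ := h
  obtain ⟨g, rfl, rfl⟩ := h'
  exact ⟨f * g, map_mul _ _ _, map_mul _ _ _⟩

theorem one : s.Specializes 1 1 := ⟨1, map_one _, map_one _⟩

theorem pow (h : s.Specializes z w) (n : ℕ) : s.Specializes (z ^ n) (w ^ n) := by
  induction n with
  | zero => simpa using one
  | succ n ih => rw [pow_succ, pow_succ]; exact ih.mul h

theorem prod {κ : Type*} [Fintype κ] {a : κ → FractionRing (MvPolynomial (ι ⊕ ι) k)} {b : κ → F}
    (h : ∀ i, s.Specializes (a i) (b i)) : s.Specializes (∏ i, a i) (∏ i, b i) := by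
  classical
  induction (Finset.univ : Finset κ) using Finset.induction_on with
  | empty => simpa using one
  | insert i t hi ih => rw [Finset.prod_insert hi, Finset.prod_insert hi]; exact (h i).mul ih

theorem unique (h : s.Specializes z w) (h' : s.Specializes z w') : w = w' := by
  obtain ⟨f, hf, rfl⟩ := h
  obtain ⟨g, hg, rfl⟩ := h'
  rw [laurentEval_injective _ s.principal.algebraicIndependent (hf.trans hg.symm)]

theorem x (v : ι ⊕ ι) : s.Specializes (s.principal.x v) (Sum.elim s.x (fun _ => 1) v) := by
  classical
  refine ⟨AddMonoidAlgebra.single (Pi.single v 1) 1, ?_, ?_⟩ <;>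
  · rw [laurentEval_single, Finset.prod_eq_single v] <;> simp +contextual

theorem mem_laurent (h : s.Specializes z w) : w ∈ s.laurent := by
  obtain ⟨f, -, rfl⟩ := h
  have hx : ∀ v, (Sum.elim s.x fun _ : ι => (1 : F)) v ≠ 0 := by
    rintro (i | i) <;> simp [s.x_ne_zero]
  have : laurentEval k _ hx f ∈ laurentOn k (Sum.elim s.x fun _ : ι => 1) Set.univ := by
    rw [← range_laurentEval hx]
    exact ⟨f, rfl⟩
  refine laurentOn_le ?_ this
  rintro (i | i) -
  · exact ⟨s.x_mem_laurent i, s.inv_x_mem_laurent i⟩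
  · simp [one_mem]

end Specializes

theorem exists_specializes_of_mem_laurent {s : Seed k F ι}
    {z : FractionRing (MvPolynomial (ι ⊕ ι) k)} (h : z ∈ s.principal.laurent) :
    ∃ w, s.Specializes z w := by
  rw [laurent, ← range_laurentEval s.principal.x_ne_zero] at h
  obtain ⟨f, hf⟩ := h
  exact ⟨_, f, hf, rfl⟩

/-- `t'` follows the mutations of `t` in the presence of principal coefficients. -/
structure IsPrincipalLift (s : Seed k F ι)
    (t' : Seed k (FractionRing (MvPolynomial (ι ⊕ ι) k)) (ι ⊕ ι)) (t : Seed k F ι) : Prop where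
  equiv : s.principal.MutationEquiv t'
  arrows : ∀ i j, t'.quiver.arrows (Sum.inl i) (Sum.inl j) = t.quiver.arrows i j
  frozen : ∀ i, Sum.inl i ∈ t'.frozen ↔ i ∈ t.frozen
  x_inl : ∀ i, s.Specializes (t'.x (Sum.inl i)) (t.x i)
  x_inr : ∀ i, s.Specializes (t'.x (Sum.inr i)) 1

/-- Specialization is a ring map on the Laurent ring only and need not respect division. The Laurent
phenomenon in full rank shows that the new variable can be specialized at all; its value is then
found by specializing the exchange relation and cancelling `t.x i`. -/
theorem IsPrincipalLift.mutate {s t : Seed k F ι}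
    {t' : Seed k (FractionRing (MvPolynomial (ι ⊕ ι) k)) (ι ⊕ ι)} (h : s.IsPrincipalLift t' t)
    {j : ι} (hj : j ∉ t.frozen) (hj' : Sum.inl j ∉ t'.frozen) :
    s.IsPrincipalLift (t'.mutate (Sum.inl j) hj') (t.mutate j hj) where
  equiv := h.equiv.trans (MutationEquiv.mutate t' hj')
  arrows a b := by
    change (t'.quiver.mutate (Sum.inl j)).arrows _ _ = (t.quiver.mutate j).arrows a b
    simp only [ClusterQuiver.mutate, ClusterQuiver.cancel, ClusterQuiver.reverseAt,
      ClusterQuiver.addPaths, h.arrows, Sum.inl.injEq]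
  frozen := h.frozen
  x_inl i := by
    by_cases hij : i = j
    · subst hij
      have hequiv := h.equiv.trans (MutationEquiv.mutate t' hj')
      obtain ⟨w, hw⟩ := exists_specializes_of_mem_laurent
        (s.principal.x_mem_laurent_of_fullRank s.principal_fullRank hequiv (Sum.inl i))
      have h1 := (h.x_inl i).mul hw
      rw [x_mul_mutate_x] at h1
      have h2 : s.Specializes (t'.exchangePoly (Sum.inl i)) (t.exchangePoly i) := by
        rw [exchangePoly, exchangePoly, Fintype.prod_sum_type, Fintype.prod_sum_type]
        refine Specializes.add ?_ ?_
        · have := (Specializes.prod fun l => (h.x_inl l).pow (t.quiver.arrows l i)).mul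
            (Specializes.prod fun l => (h.x_inr l).pow (t'.quiver.arrows (Sum.inr l) (Sum.inl i)))
          simpa [h.arrows] using this
        · have := (Specializes.prod fun l => (h.x_inl l).pow (t.quiver.arrows i l)).mul
            (Specializes.prod fun l => (h.x_inr l).pow (t'.quiver.arrows (Sum.inl i) (Sum.inr l)))
          simpa [h.arrows] using this
      have h3 := h1.unique h2
      rw [← x_mul_mutate_x t hj] at h3
      rw [← mul_left_cancel₀ (t.x_ne_zero i) h3]
      exact hw
    · rw [mutate_x_of_ne _ _ hij, mutate_x_of_ne _ _ (by simpa using hij)]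
      exact h.x_inl i
  x_inr i := by
    rw [mutate_x_of_ne _ _ (by simp)]
    exact h.x_inr i

theorem exists_isPrincipalLift {s t : Seed k F ι} (h : s.MutationEquiv t) :
    ∃ t', s.IsPrincipalLift t' t := by
  induction h with
  | refl =>
    exact ⟨s.principal, Relation.ReflTransGen.refl, fun _ _ => rfl, fun _ => Iff.rfl,
      fun i => Specializes.x (Sum.inl i), fun i => Specializes.x (Sum.inr i)⟩
  | tail _ h ih =>
    obtain ⟨j, hj, rfl⟩ := h
    obtain ⟨t', ht'⟩ := ih
    exact ⟨_, ht'.mutate hj (mt (ht'.frozen j).1 hj)⟩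

/-- The Laurent phenomenon. -/
theorem clusterAlgebra_le_laurent (s : Seed k F ι) : s.clusterAlgebra ≤ s.laurent := by
  refine Algebra.adjoin_le ?_
  rintro y (⟨t, hst, i, rfl⟩ | ⟨i, -, rfl⟩)
  · obtain ⟨t', ht'⟩ := exists_isPrincipalLift hst
    exact (ht'.x_inl i).mem_laurent
  · exact s.inv_x_mem_laurent i

end Seed

/-! ### Lower bounds, and the cluster algebra of an acyclic seed. -/

namespace Seed

variable {k F ι : Type*} [Field k] [Field F] [Algebra k F] [Fintype ι]

open Classical in
/-- The algebra generated by the cluster, the mutated variables at the vertices in `V`, and the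
inverses of the other variables. -/
noncomputable def mixed (s : Seed k F ι) (V : Set ι) : Subalgebra k F :=
  Algebra.adjoin k {y | ∃ l, y = s.x l ∨ y = (if l ∈ V then s.exchangePoly l else 1) * (s.x l)⁻¹}

/-- The lower bound of a seed: the algebra generated by its cluster, the adjacent cluster variables
and the inverses of the frozen variables. -/
noncomputable def lower (s : Seed k F ι) : Subalgebra k F := s.mixed s.frozenᶜ

section

variable {s : Seed k F ι} {V : Set ι}

theorem x_mem_mixed (l : ι) : s.x l ∈ s.mixed V := Algebra.subset_adjoin ⟨l, Or.inl rfl⟩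

theorem mul_inv_mem_mixed {l : ι} (hl : l ∈ V) : s.exchangePoly l * (s.x l)⁻¹ ∈ s.mixed V :=
  Algebra.subset_adjoin ⟨l, Or.inr (by simp [hl])⟩

theorem inv_mem_mixed {l : ι} (hl : l ∉ V) : (s.x l)⁻¹ ∈ s.mixed V :=
  Algebra.subset_adjoin ⟨l, Or.inr (by simp [hl])⟩

theorem mixed_le {A : Subalgebra k F} (h1 : ∀ l, s.x l ∈ A)
    (h2 : ∀ l ∈ V, s.exchangePoly l * (s.x l)⁻¹ ∈ A) (h3 : ∀ l, l ∉ V → (s.x l)⁻¹ ∈ A) :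
    s.mixed V ≤ A := by
  refine Algebra.adjoin_le ?_
  rintro _ ⟨l, rfl | rfl⟩
  · exact h1 l
  · by_cases hl : l ∈ V
    · simpa [hl] using h2 l hl
    · simpa [hl] using h3 l hl

theorem exchangePoly_mem_of_forall {A : Subalgebra k F} (h : ∀ l, s.x l ∈ A) (j : ι) :
    s.exchangePoly j ∈ A :=
  add_mem (prod_mem fun l _ => pow_mem (h l) _) (prod_mem fun l _ => pow_mem (h l) _)

theorem exchangePoly_mem_of_ne {A : Subalgebra k F} {j : ι} (h : ∀ l, l ≠ j → s.x l ∈ A) :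
    s.exchangePoly j ∈ A := by
  refine add_mem (prod_mem fun l _ => ?_) (prod_mem fun l _ => ?_) <;>
  · by_cases hl : l = j
    · subst hl; simp [s.quiver.no_loop, one_mem]
    · exact pow_mem (h l hl) _

end

/-- There are no arrows between mutable vertices. -/
def IsIsolated (s : Seed k F ι) : Prop :=
  ∀ i j, i ∉ s.frozen → j ∉ s.frozen → s.quiver.arrows i j = 0

variable [DecidableEq ι]

theorem IsIsolated.mutate {s : Seed k F ι} (h : s.IsIsolated) {i : ι} (hi : i ∉ s.frozen) :
    (s.mutate i hi).IsIsolated := by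
  intro a b ha hb
  by_cases hib : i = b
  · subst hib
    exact (s.quiver.arrows_mutate_right i a).trans (h i a hi ha)
  · exact (s.arrows_mutate_of_isolated hi hib (h i b hi hb) (h b i hb hi) a).1.trans (h a b ha hb)

/-- The elements that are Laurent polynomials in every cluster. -/
def upper (s : Seed k F ι) : Set F := {y | ∀ t, s.MutationEquiv t → y ∈ t.laurent}

theorem upper_mutate (s : Seed k F ι) {i : ι} (hi : i ∉ s.frozen) :
    s.upper ⊆ (s.mutate i hi).upper :=
  fun _ hy t ht => hy t ((MutationEquiv.mutate s hi).trans ht)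

theorem clusterAlgebra_subset_upper (s : Seed k F ι) : (s.clusterAlgebra : Set F) ⊆ s.upper := by
  intro y hy t ht
  rw [← ht.clusterAlgebra_eq] at hy
  exact t.clusterAlgebra_le_laurent hy

theorem lower_le_clusterAlgebra (s : Seed k F ι) : s.lower ≤ s.clusterAlgebra := by
  refine mixed_le (fun l => ?_) (fun l hl => ?_) (fun l hl => ?_)
  · exact Algebra.subset_adjoin (Or.inl ⟨s, Relation.ReflTransGen.refl, l, rfl⟩)
  · rw [← mutate_x_self s hl]
    exact Algebra.subset_adjoin (Or.inl ⟨_, MutationEquiv.mutate s hl, l, rfl⟩)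
  · exact Algebra.subset_adjoin (Or.inr ⟨l, not_not.1 hl, rfl⟩)

/-- `mixed` interpolates between the Laurent ring, `V = ∅`, and the lower bound. Adding `i` to `V`
intersects `B[x i, (x i)⁻¹]` with its mutated counterpart; isolation keeps `x i` out of the exchange
polynomials at `V` and makes `B` the same for both seeds. -/
theorem upper_subset_mixed {V : Set ι} (s : Seed k F ι) (h : s.IsIsolated)
    (hV : ∀ i ∈ V, i ∉ s.frozen) : s.upper ⊆ s.mixed V := by
  classical
  induction V, V.toFinite using Set.Finite.induction_on generalizing s with
  | empty =>
    intro y hy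
    exact laurentOn_le (fun i _ => ⟨x_mem_mixed i, inv_mem_mixed (by simp)⟩)
      (hy s Relation.ReflTransGen.refl)
  | @insert i V hiV _ ih =>
    have hi : i ∉ s.frozen := hV i (by simp)
    have hV' : ∀ l ∈ V, l ∉ s.frozen := fun l hl => hV l (by simp [hl])
    intro y hy
    have h1 := ih s h hV' hy
    have h2 := ih (s.mutate i hi) (h.mutate hi) hV' (s.upper_mutate hi hy)
    set B : Subalgebra k F := Algebra.adjoin k {y | ∃ l, l ≠ i ∧
      (y = s.x l ∨ y = (if l ∈ V then s.exchangePoly l else 1) * (s.x l)⁻¹)} with hB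
    have hBx : ∀ l, l ≠ i → s.x l ∈ B := fun l hl => Algebra.subset_adjoin ⟨l, hl, Or.inl rfl⟩
    have hBv : ∀ l ∈ V, s.exchangePoly l * (s.x l)⁻¹ ∈ B := fun l hl =>
      Algebra.subset_adjoin ⟨l, by rintro rfl; exact hiV hl, Or.inr (by simp [hl])⟩
    have hBi : ∀ l, l ∉ V → l ≠ i → (s.x l)⁻¹ ∈ B := fun l hl hl' =>
      Algebra.subset_adjoin ⟨l, hl', Or.inr (by simp [hl])⟩
    have hsub : ∀ z z' : F, B ≤ Algebra.adjoin k ((B : Set F) ∪ {z, z'}) :=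
      fun _ _ _ hz => Algebra.subset_adjoin (Or.inl hz)
    have key := mem_adjoin_pair_of_mem_laurent (B := B) (x := s.x i) (x' := (s.mutate i hi).x i)
      (y := y) (s.transcendental i ?_) (x_ne_zero _ _) ?_ ?_ ?_
    · refine Algebra.adjoin_le ?_ key
      rintro z (hz | rfl | rfl)
      · refine (Algebra.adjoin_le ?_ : B ≤ _) hz
        rintro _ ⟨l, hl, rfl | rfl⟩
        · exact x_mem_mixed l
        · by_cases hlV : l ∈ V
          · rw [if_pos hlV]; exact mul_inv_mem_mixed (by simp [hlV])
          · rw [if_neg hlV, one_mul]; exact inv_mem_mixed (by simp [hlV, hl])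
      · exact x_mem_mixed i
      · rw [mutate_x_self]; exact mul_inv_mem_mixed (by simp)
    · refine Algebra.adjoin_le ?_
      have hK : ∀ l, l ≠ i → s.x l ∈ IntermediateField.adjoin k (s.x '' {i}ᶜ) := fun l hl =>
        IntermediateField.subset_adjoin _ _ ⟨l, by simpa using hl, rfl⟩
      rintro _ ⟨l, hl, rfl | rfl⟩
      · exact hK l hl
      · refine mul_mem ?_ (inv_mem (S := IntermediateField k F) (hK l hl))
        split_ifs with hlV
        · refine s.laurentOn_compl_le_adjoin i (add_mem ?_ ?_)
          · exact prod_pow_mem_laurentOn _ (by simpa using h i l hi (hV' l hlV))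
          · exact prod_pow_mem_laurentOn _ (by simpa using h l i (hV' l hlV) hi)
        · exact one_mem _
    · rw [x_mul_mutate_x]
      exact exchangePoly_mem_of_ne hBx
    · refine mixed_le (fun l => ?_) (fun l hl => hsub _ _ (hBv l hl)) (fun l hl => ?_) h1
      · by_cases hl : l = i
        · subst hl; exact Algebra.subset_adjoin (by simp)
        · exact hsub _ _ (hBx l hl)
      · by_cases hl' : l = i
        · subst hl'; exact Algebra.subset_adjoin (by simp)
        · exact hsub _ _ (hBi l hl hl')
    · refine mixed_le (fun l => ?_) (fun l hl => hsub _ _ ?_) (fun l hl => ?_) h2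
      · by_cases hl : l = i
        · subst hl; exact Algebra.subset_adjoin (by simp)
        · rw [mutate_x_of_ne s hi hl]; exact hsub _ _ (hBx l hl)
      · have hl' : l ≠ i := by rintro rfl; exact hiV hl
        rw [mutate_x_of_ne s hi hl', exchangePoly_mutate_of_isolated s hi hl'.symm
          (h i l hi (hV' l hl)) (h l i (hV' l hl) hi)]
        exact hBv l hl
      · by_cases hl' : l = i
        · subst hl'; exact Algebra.subset_adjoin (by simp)
        · rw [mutate_x_of_ne s hi hl']; exact hsub _ _ (hBi l hl hl')

omit [Fintype ι] [DecidableEq ι] in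
theorem IsAcyclicSeed.freeze {s : Seed k F ι} (h : s.IsAcyclicSeed) (S : Set ι) :
    (s.freeze S).IsAcyclicSeed :=
  fun i hi => h i (Relation.TransGen.mono (fun _ _ ⟨h1, h2, h3⟩ =>
    ⟨fun h => h1 (Or.inl h), fun h => h2 (Or.inl h), h3⟩) i i hi)

/-- Every seed reachable after freezing is the freezing of a seed reachable before, with the same
cluster. No comparison of the cluster algebras themselves is needed. -/
theorem upper_subset_freeze (s : Seed k F ι) (S : Set ι) : s.upper ⊆ (s.freeze S).upper := by
  intro y hy t ht
  have : ∃ t₀ : Seed k F ι, s.MutationEquiv t₀ ∧ t = t₀.freeze S := by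
    induction ht with
    | refl => exact ⟨s, Relation.ReflTransGen.refl, rfl⟩
    | tail _ h ih =>
      obtain ⟨j, hj, rfl⟩ := h
      obtain ⟨t₀, h₀, rfl⟩ := ih
      have hj' : j ∉ t₀.frozen := fun h => hj (Or.inl h)
      exact ⟨t₀.mutate j hj', h₀.tail ⟨j, hj', rfl⟩, rfl⟩
  obtain ⟨t₀, h₀, rfl⟩ := this
  exact hy t₀ h₀

omit [DecidableEq ι] in
theorem leLocalization_freeze (s : Seed k F ι) (i : ι) :
    LeLocalization s.lower (s.freeze {i}).lower (s.x i) where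
  le := by
    have hx : ∀ l, s.x l ∈ (s.freeze {i}).lower := fun l => x_mem_mixed (s := s.freeze {i}) l
    refine mixed_le hx (fun l hl => ?_) (fun l hl => ?_)
    · by_cases hli : l = i
      · refine mul_mem (exchangePoly_mem_of_forall hx l) ?_
        exact inv_mem_mixed (s := s.freeze {i}) (by simp [freeze, hli])
      · refine mul_inv_mem_mixed (s := s.freeze {i}) ?_
        simp only [freeze, Set.mem_compl_iff, Set.mem_union, Set.mem_singleton_iff, not_or]
        exact ⟨hl, hli⟩
    · refine inv_mem_mixed (s := s.freeze {i}) fun h => h ?_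
      exact Or.inl (not_not.1 hl)
  mem := x_mem_mixed i
  exists_pow_mul_mem y hy := by
    refine exists_pow_mul_mem_of_mem_adjoin (x_mem_mixed i) ?_ hy
    rintro _ ⟨l, rfl | rfl⟩
    · refine ⟨0, ?_⟩
      rw [pow_zero, one_mul]
      exact x_mem_mixed (s := s) l
    · by_cases hl : l ∈ (s.freeze {i}).frozenᶜ
      · rw [if_pos hl]
        refine ⟨0, ?_⟩
        rw [pow_zero, one_mul]
        exact mul_inv_mem_mixed (s := s) fun h => hl (Or.inl h)
      · rw [if_neg hl, one_mul]
        rcases not_not.1 hl with hl | hl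
        · refine ⟨0, ?_⟩
          rw [pow_zero, one_mul]
          exact inv_mem_mixed (s := s) fun h => h hl
        · obtain rfl : l = i := hl
          refine ⟨1, ?_⟩
          change s.x l ^ 1 * (s.x l)⁻¹ ∈ _
          rw [pow_one, mul_inv_cancel₀ (s.x_ne_zero l)]
          exact one_mem _

omit [DecidableEq ι] in
/-- An acyclic seed with arrows between mutable vertices has two mutable vertices whose variables
generate the unit ideal of the lower bound. -/
theorem IsAcyclicSeed.exists_comaximal {s : Seed k F ι} (h : s.IsAcyclicSeed)
    (hs : ¬ s.IsIsolated) : ∃ i j, i ∉ s.frozen ∧ j ∉ s.frozen ∧ ∃ a ∈ s.lower, ∃ b ∈ s.lower,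
      ∃ u : F, u⁻¹ ∈ s.lower ∧ u ≠ 0 ∧ u = s.x i * a + s.x j * b := by
  classical
  let r : ι → ι → Prop := Relation.TransGen
    (fun a b => a ∉ s.frozen ∧ b ∉ s.frozen ∧ 0 < s.quiver.arrows a b)
  have : IsTrans ι r := ⟨fun _ _ _ => Relation.TransGen.trans⟩
  have : Std.Irrefl r := ⟨h⟩
  have hwf : WellFounded r := Finite.wellFounded_of_trans_of_irrefl r
  have hne : {i | i ∉ s.frozen ∧ ∃ j, j ∉ s.frozen ∧ 0 < s.quiver.arrows i j}.Nonempty := by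
    simp only [IsIsolated] at hs
    push Not at hs
    obtain ⟨i, j, hi, hj, hij⟩ := hs
    exact ⟨i, hi, j, hj, Nat.pos_of_ne_zero hij⟩
  -- A minimal vertex with an outgoing mutable arrow is a source of the mutable part, since a
  -- mutable predecessor would have such an arrow too. In its exchange relation the incoming
  -- monomial is therefore frozen, hence a unit, and the outgoing one is divisible by `x j`.
  obtain ⟨i, ⟨hi, j, hj, hij⟩, hmin⟩ := hwf.has_min _ hne
  have hsource : ∀ l, l ∉ s.frozen → s.quiver.arrows l i = 0 := by
    intro l hl
    by_contra hli
    exact hmin l ⟨hl, i, hi, Nat.pos_of_ne_zero hli⟩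
      (Relation.TransGen.single ⟨hl, hi, Nat.pos_of_ne_zero hli⟩)
  have hx : ∀ l, s.x l ∈ s.lower := fun l => x_mem_mixed l
  set b := s.x j ^ (s.quiver.arrows i j - 1) *
    ∏ l ∈ Finset.univ.erase j, s.x l ^ s.quiver.arrows i l with hb
  have hsplit : ∏ l, s.x l ^ s.quiver.arrows i l = s.x j * b := by
    rw [← Finset.mul_prod_erase _ _ (Finset.mem_univ j), hb, ← mul_assoc, ← pow_succ',
      Nat.sub_add_cancel (by omega)]
  refine ⟨i, j, hi, hj, s.exchangePoly i * (s.x i)⁻¹, mul_inv_mem_mixed hi, -b,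
    neg_mem (mul_mem (pow_mem (hx j) _) (prod_mem fun l _ => pow_mem (hx l) _)),
    ∏ l, s.x l ^ s.quiver.arrows l i, ?_, s.prod_pow_ne_zero _, ?_⟩
  · have hle : laurentOn k s.x s.frozen ≤ s.lower :=
      laurentOn_le fun l hl => ⟨hx l, inv_mem_mixed (by simpa using hl)⟩
    exact hle (inv_prod_pow_mem_laurentOn _ hsource)
  · have := s.x_ne_zero i
    rw [mul_comm (s.exchangePoly i), mul_inv_cancel_left₀ this, exchangePoly, hsplit]
    ring

omit [DecidableEq ι] in
/-- Induction for acyclic seeds by covering with isolated ones. -/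
theorem IsAcyclicSeed.induction {motive : Seed k F ι → Prop}
    (isolated : ∀ s, s.IsIsolated → motive s)
    (cover : ∀ (s : Seed k F ι) (i j : ι), (∃ a ∈ s.lower, ∃ b ∈ s.lower,
      ∃ u : F, u⁻¹ ∈ s.lower ∧ u ≠ 0 ∧ u = s.x i * a + s.x j * b) →
      motive (s.freeze {i}) → motive (s.freeze {j}) → motive s)
    {s : Seed k F ι} (h : s.IsAcyclicSeed) : motive s := by
  induction hn : s.frozenᶜ.ncard using Nat.strong_induction_on generalizing s with
  | _ n ih =>
  subst hn
  by_cases hs : s.IsIsolated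
  · exact isolated s hs
  obtain ⟨i, j, hi, hj, hco⟩ := h.exists_comaximal hs
  have hlt : ∀ i, i ∉ s.frozen → (s.freeze {i}).frozenᶜ.ncard < s.frozenᶜ.ncard := fun i hi =>
    Set.ncard_lt_ncard ⟨fun l hl h => hl (Or.inl h), fun hsub => hsub hi (Or.inr rfl)⟩
  exact cover s i j hco (ih _ (hlt i hi) (h.freeze _) rfl) (ih _ (hlt j hj) (h.freeze _) rfl)

/-- In the covering step, the element lies in the localizations of the lower bound at two comaximal
variables, hence in the lower bound. -/
theorem IsAcyclicSeed.upper_subset_lower {s : Seed k F ι} (h : s.IsAcyclicSeed) :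
    s.upper ⊆ s.lower := by
  refine h.induction (motive := fun s => s.upper ⊆ s.lower)
    (fun s hs => s.upper_subset_mixed hs fun i hi => hi) ?_
  rintro s i j ⟨a, ha, b, hb, u, hu, hu0, hab⟩ hi hj y hy
  obtain ⟨m, hm⟩ := (s.leLocalization_freeze i).exists_pow_mul_mem y
    (hi (s.upper_subset_freeze _ hy))
  obtain ⟨n, hn⟩ := (s.leLocalization_freeze j).exists_pow_mul_mem y
    (hj (s.upper_subset_freeze _ hy))
  exact mem_of_pow_mul_mem (x_mem_mixed i) (x_mem_mixed j) ha hb hu hu0 hab hm hn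

/-- The cluster algebra of an acyclic seed is its lower bound. -/
theorem IsAcyclicSeed.clusterAlgebra_eq_lower {s : Seed k F ι} (h : s.IsAcyclicSeed) :
    s.clusterAlgebra = s.lower :=
  le_antisymm (fun _ hy => h.upper_subset_lower (s.clusterAlgebra_subset_upper hy))
    s.lower_le_clusterAlgebra

end Seed

/-! ### Trace maps on Laurent polynomial rings. -/

section Trace

variable {k ι : Type*} [Field k]

/-- Over a field, the inclusion `k → k^{1/p^e}` is an injective linear map and so has a linear left
inverse. -/
theorem exists_isPowInvLinear (p : ℕ) [Fact p.Prime] [CharP k p] (e : ℕ) :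
    ∃ f : k →+ k, IsPowInvLinear (p ^ e) f ∧ f 1 = 1 := by
  obtain ⟨g, hg⟩ := (Algebra.linearMap k (FrobRoot p k e)).exists_leftInverse_of_injective
    (LinearMap.ker_eq_bot.2 (iterateFrobenius k p e).injective)
  refine ⟨⟨⟨fun x => g (FrobRoot.root p k e x), by simp⟩, fun x y => by simp⟩, fun r x => ?_, ?_⟩
  · change g (FrobRoot.root p k e (r ^ p ^ e * x)) = r * g (FrobRoot.root p k e x)
    rw [← FrobRoot.smul_root, map_smul, smul_eq_mul]
  · have := LinearMap.congr_fun hg 1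
    simpa using this

theorem natCast_mul_injective {q : ℕ} (hq : q ≠ 0) :
    Function.Injective fun a : ι → ℤ => q • a :=
  smul_right_injective _ hq

open AddMonoidAlgebra

/-- The standard `q`-inverse linear map on a Laurent polynomial ring: the coefficient at `b` of the
image is obtained from the coefficient at `q • b` by the map `f`. -/
noncomputable def laurentTrace {q : ℕ} (hq : q ≠ 0) (f : k →+ k) :
    AddMonoidAlgebra k (ι → ℤ) →+ AddMonoidAlgebra k (ι → ℤ) where
  toFun g := AddMonoidAlgebra.map f (comapDomain _ (natCast_mul_injective hq) g)
  map_zero' := by simp [AddMonoidAlgebra.map_zero]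
  map_add' := by simp [AddMonoidAlgebra.map_add]

theorem coeff_laurentTrace {q : ℕ} (hq : q ≠ 0) (f : k →+ k) (g : AddMonoidAlgebra k (ι → ℤ))
    (b : ι → ℤ) : (laurentTrace hq f g).coeff b = f (g.coeff (q • b)) := by
  simp [laurentTrace]

/-- Both sides are additive in `r`, by additivity of Frobenius, so `r` may be taken to be a
monomial; its `p ^ e`-th power shifts exponents by a multiple of `p ^ e`. -/
theorem isPowInvLinear_laurentTrace {p : ℕ} [Fact p.Prime] [CharP k p] {e : ℕ} {f : k →+ k}
    (hf : IsPowInvLinear (p ^ e) f) :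
    IsPowInvLinear (p ^ e) (laurentTrace (ι := ι)
      (pow_ne_zero e (Fact.out : p.Prime).ne_zero) f) := by
  have : CharP (AddMonoidAlgebra k (ι → ℤ)) p :=
    charP_of_injective_algebraMap (algebraMap k _).injective p
  intro r g
  induction r using AddMonoidAlgebra.induction_linear with
  | zero => simp [(Fact.out : p.Prime).ne_zero]
  | add x y hx hy => rw [add_pow_char_pow, add_mul, map_add, hx, hy, add_mul]
  | single a c =>
    ext b
    rw [coeff_laurentTrace, single_pow, coeff_single_mul_apply, coeff_single_mul_apply,
      coeff_laurentTrace, hf]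
    congr 3
    rw [smul_add, smul_neg]

end Trace

/-! ### Laurent polynomials in a subset of the variables. -/

section Supported

variable {k ι : Type*} [Field k]

/-- The Laurent polynomials involving only the variables in `V`. -/
noncomputable def laurentSupported (k : Type*) {ι : Type*} [Field k] (V : Set ι) :
    Subalgebra k (AddMonoidAlgebra k (ι → ℤ)) where
  carrier := {f | ∀ a, f.coeff a ≠ 0 → ∀ i, i ∉ V → a i = 0}
  mul_mem' := by
    classical
    intro f g hf hg a ha i hi
    have := AddMonoidAlgebra.support_coeff_mul_subset f g (Finsupp.mem_support_iff.2 ha)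
    obtain ⟨b, hb, c, hc, rfl⟩ := Finset.mem_add.1 this
    simp [hf b (Finsupp.mem_support_iff.1 hb) i hi, hg c (Finsupp.mem_support_iff.1 hc) i hi]
  add_mem' := by
    intro f g hf hg a ha i hi
    by_contra hai
    apply ha
    rw [AddMonoidAlgebra.coeff_add, Finsupp.add_apply,
      not_not.1 fun h => hai (hf a h i hi), not_not.1 fun h => hai (hg a h i hi), add_zero]
  algebraMap_mem' := by
    classical
    intro c a ha i _
    rw [AddMonoidAlgebra.coe_algebraMap, Function.comp_apply, AddMonoidAlgebra.coeff_single,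
      Finsupp.single_apply] at ha
    split_ifs at ha with h
    · rw [← h]; rfl
    · exact absurd rfl ha

theorem mem_laurentSupported {V : Set ι} {f : AddMonoidAlgebra k (ι → ℤ)} :
    f ∈ laurentSupported k V ↔ ∀ a, f.coeff a ≠ 0 → ∀ i, i ∉ V → a i = 0 := Iff.rfl

theorem single_mem_laurentSupported {V : Set ι} {a : ι → ℤ} (ha : ∀ i, i ∉ V → a i = 0) (c : k) :
    AddMonoidAlgebra.single a c ∈ laurentSupported k V := by
  classical
  intro b hb i hi
  rw [AddMonoidAlgebra.coeff_single, Finsupp.single_apply] at hb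
  split_ifs at hb with h
  · rw [← h]; exact ha i hi
  · exact absurd rfl hb

/-- The Laurent monomial with exponent vector `a`. -/
noncomputable def laurentMono (k : Type*) {ι : Type*} [Field k] (a : ι → ℤ) :
    AddMonoidAlgebra k (ι → ℤ) := AddMonoidAlgebra.single a 1

theorem laurentEval_mem_laurentOn {F : Type*} [Field F] [Algebra k F] [Fintype ι] {x : ι → F}
    (hx : ∀ i, x i ≠ 0) {V : Set ι} {f : AddMonoidAlgebra k (ι → ℤ)}
    (hf : f ∈ laurentSupported k V) : laurentEval k x hx f ∈ laurentOn k x V := by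
  rw [laurentEval_apply]
  exact sum_mem fun a ha => mul_mem (Subalgebra.algebraMap_mem _ _)
    (prod_zpow_mem_laurentOn a (hf a (Finsupp.mem_support_iff.1 ha)))

end Supported

/-! ### The lower bound as an algebra of Laurent polynomials. -/

namespace Seed

variable {k F ι : Type*} [Field k] [Field F] [Algebra k F] [Fintype ι]

/-- The Laurent expansion map of a seed. -/
noncomputable def eval (s : Seed k F ι) : AddMonoidAlgebra k (ι → ℤ) →ₐ[k] F :=
  laurentEval k s.x s.x_ne_zero

theorem eval_injective (s : Seed k F ι) : Function.Injective s.eval :=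
  laurentEval_injective s.x_ne_zero s.algebraicIndependent

theorem eval_single (s : Seed k F ι) (a : ι → ℤ) (c : k) :
    s.eval (AddMonoidAlgebra.single a c) = algebraMap k F c * ∏ i, s.x i ^ a i :=
  laurentEval_single _ a c

open Classical in
/-- The Laurent polynomial of the product of a variable and its partner in the lower bound. -/
noncomputable def partnerPoly (s : Seed k F ι) (l : ι) : AddMonoidAlgebra k (ι → ℤ) :=
  if l ∈ s.frozenᶜ then AddMonoidAlgebra.single (fun i => (s.quiver.arrows i l : ℤ)) 1 +
    AddMonoidAlgebra.single (fun i => (s.quiver.arrows l i : ℤ)) 1 else 1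

open Classical in
/-- The generators of the lower bound, as Laurent polynomials. -/
noncomputable def gen (s : Seed k F ι) (v : ι ⊕ ι) : AddMonoidAlgebra k (ι → ℤ) :=
  Sum.elim (fun i => laurentMono k (Pi.single i 1))
    (fun i => s.partnerPoly i * laurentMono k (Pi.single i (-1))) v

theorem eval_laurentMono_single [DecidableEq ι] (s : Seed k F ι) (i : ι) (n : ℤ) :
    s.eval (laurentMono k (Pi.single i n)) = s.x i ^ n := by
  rw [laurentMono, eval_single, Finset.prod_eq_single i] <;> simp +contextual

open Classical in
theorem eval_partnerPoly (s : Seed k F ι) (l : ι) :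
    s.eval (s.partnerPoly l) = if l ∈ s.frozenᶜ then s.exchangePoly l else 1 := by
  unfold partnerPoly
  split_ifs with h
  · rw [map_add, eval_single, eval_single]
    simp [exchangePoly]
  · exact map_one _

theorem lower_eq_map (s : Seed k F ι) :
    s.lower = (Algebra.adjoin k (Set.range s.gen)).map s.eval := by
  classical
  rw [AlgHom.map_adjoin, lower, mixed]
  congr 1
  ext y
  constructor
  · rintro ⟨l, rfl | rfl⟩
    · exact ⟨_, ⟨Sum.inl l, rfl⟩, by simp [gen, eval_laurentMono_single]⟩
    · exact ⟨_, ⟨Sum.inr l, rfl⟩, by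
        simp only [gen, Sum.elim_inr, map_mul, eval_laurentMono_single, eval_partnerPoly, zpow_neg_one]
        split_ifs <;> rfl⟩
  · rintro ⟨_, ⟨l | l, rfl⟩, rfl⟩
    · exact ⟨l, Or.inl (by simp [gen, eval_laurentMono_single])⟩
    · exact ⟨l, Or.inr (by
        simp only [gen, Sum.elim_inr, map_mul, eval_laurentMono_single, eval_partnerPoly, zpow_neg_one]
        split_ifs <;> rfl)⟩

omit [Fintype ι] in
theorem IsIsolated.partnerPoly_mem {s : Seed k F ι} (h : s.IsIsolated) (l : ι) :
    s.partnerPoly l ∈ laurentSupported k s.frozen := by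
  unfold partnerPoly
  split_ifs with hl
  · exact add_mem
      (single_mem_laurentSupported (fun i hi => by exact_mod_cast h i l hi hl) _)
      (single_mem_laurentSupported (fun i hi => by exact_mod_cast h l i hl hi) _)
  · exact one_mem _

end Seed

/-! ### Strong `F`-regularity of the lower bound of an isolated seed. -/

namespace Seed

variable {k F ι : Type*} [Field k] [Field F] [Algebra k F] [Fintype ι]

theorem mem_adjoin_gen_iff (s : Seed k F ι) (g : AddMonoidAlgebra k (ι → ℤ)) :
    g ∈ Algebra.adjoin k (Set.range s.gen) ↔ s.eval g ∈ s.lower := by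
  rw [lower_eq_map]
  constructor
  · exact fun h => ⟨g, h, rfl⟩
  · rintro ⟨g', h', he⟩
    rwa [← s.eval_injective he]

theorem laurentOn_frozen_le_lower (s : Seed k F ι) : laurentOn k s.x s.frozen ≤ s.lower :=
  laurentOn_le fun l hl => ⟨x_mem_mixed l, inv_mem_mixed (by simpa using hl)⟩

theorem prod_gen_pow (s : Seed k F ι) (r : ι ⊕ ι → ℕ) :
    ∏ v, s.gen v ^ r v = (∏ i, s.partnerPoly i ^ r (Sum.inr i)) *
      laurentMono k (fun i => (r (Sum.inl i) : ℤ) - r (Sum.inr i)) := by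
  classical
  apply s.eval_injective
  rw [Fintype.prod_sum_type, map_mul, map_mul, map_prod, map_prod, map_prod, laurentMono,
    eval_single, map_one, one_mul, ← Finset.prod_mul_distrib, ← Finset.prod_mul_distrib]
  refine Finset.prod_congr rfl fun i _ => ?_
  simp only [gen, Sum.elim_inl, Sum.elim_inr, map_pow, map_mul, zpow_sub₀ (s.x_ne_zero i),
    zpow_natCast]
  rw [eval_laurentMono_single, eval_laurentMono_single]
  rw [zpow_neg_one, zpow_one, mul_pow, inv_pow, div_eq_mul_inv]
  ring

variable {p : ℕ} [Fact p.Prime] [CharP k p]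

/-- The standard inverse linear map preserves the lower bound of an isolated seed. -/
theorem IsIsolated.laurentTrace_mem {s : Seed k F ι} (h : s.IsIsolated) {e : ℕ} {f : k →+ k}
    (hf : IsPowInvLinear (p ^ e) f) {g : AddMonoidAlgebra k (ι → ℤ)} (hg : s.eval g ∈ s.lower) :
    s.eval (laurentTrace (pow_ne_zero e (Fact.out : p.Prime).ne_zero) f g) ∈ s.lower := by
  set q := p ^ e with hq
  have hq0 : q ≠ 0 := pow_ne_zero e (Fact.out : p.Prime).ne_zero
  have htr := isPowInvLinear_laurentTrace (ι := ι) hf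
  rw [← mem_adjoin_gen_iff] at hg
  -- The trace is additive but not `k`-linear, so an arbitrary scalar is carried through the span
  -- induction.
  have key : ∀ c : k, s.eval (laurentTrace hq0 f (c • g)) ∈ s.lower := by
    rw [← Subalgebra.mem_toSubmodule, Algebra.adjoin_eq_span] at hg
    induction hg using Submodule.span_induction with
    | zero => simp [zero_mem]
    | add x y _ _ hx hy =>
      intro c
      rw [smul_add, map_add, map_add]
      exact add_mem (hx c) (hy c)
    | smul d x _ hx =>
      intro c
      rw [smul_smul]
      exact hx _
    | mem x hx =>
      intro c
      obtain ⟨a, rfl⟩ := Submonoid.exists_of_mem_closure_range _ _ hx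
      -- Division of the exponents by `q` with remainder: the `q`-th power comes out of the trace,
      -- leaving generators with exponents below `q`.
      have hsplit : c • ∏ v, s.gen v ^ a v = (∏ v, s.gen v ^ (a v / q)) ^ q *
          (c • ∏ v, s.gen v ^ (a v % q)) := by
        rw [mul_smul_comm, ← Finset.prod_pow, ← Finset.prod_mul_distrib]
        congr 1
        refine Finset.prod_congr rfl fun v _ => ?_
        rw [← pow_mul, ← pow_add, Nat.div_add_mod']
      rw [hsplit, htr, map_mul]
      refine mul_mem ?_ ?_
      · rw [← mem_adjoin_gen_iff]
        exact prod_mem fun v _ => pow_mem (Algebra.subset_adjoin (R := k) (Set.mem_range_self (f := s.gen) v)) _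
      refine s.laurentOn_frozen_le_lower (laurentEval_mem_laurentOn _ ?_)
      -- The partner polynomials involve frozen variables only. At a mutable `i` the exponents of
      -- the remainder thus equal a difference of two numbers in `[0, q)`, which is a multiple of
      -- `q` only when it is `0`; so the trace of the remainder is Laurent in the frozen variables.
      intro b hb i hi
      rw [coeff_laurentTrace, prod_gen_pow] at hb
      have hb' := mt (fun h0 => (congrArg f h0).trans (map_zero f)) hb
      rw [laurentMono, AddMonoidAlgebra.coeff_smul, Finsupp.smul_apply,
        AddMonoidAlgebra.coeff_mul_single_apply, mul_one] at hb'
      have hG : ∏ i, s.partnerPoly i ^ (a (Sum.inr i) % q) ∈ laurentSupported k s.frozen :=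
        prod_mem fun i _ => pow_mem (h.partnerPoly_mem i) _
      have h0 := mem_laurentSupported.1 hG _ (fun h0 => hb' (by rw [h0, smul_zero])) i hi
      have h1 := Nat.mod_lt (a (Sum.inl i)) (Nat.pos_of_ne_zero hq0)
      have h2 := Nat.mod_lt (a (Sum.inr i)) (Nat.pos_of_ne_zero hq0)
      rw [Pi.add_apply, Pi.smul_apply, Pi.neg_apply, nsmul_eq_mul, ← hq] at h0
      have h3 : (q : ℤ) * b i = ((a (Sum.inl i) % q : ℕ) : ℤ) - (a (Sum.inr i) % q : ℕ) := by
        push_cast at h0 ⊢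
        linarith
      have h4 : |(q : ℤ) * b i| < q := by rw [h3, abs_lt]; omega
      rw [abs_mul, Nat.abs_cast] at h4
      by_contra hbi
      have := Int.one_le_abs hbi
      nlinarith
  simpa using key 1

theorem IsIsolated.exists_trace {s : Seed k F ι} (h : s.IsIsolated) {e : ℕ} {f : k →+ k}
    (hf : IsPowInvLinear (p ^ e) f) : ∃ τ : s.lower →+ s.lower, IsPowInvLinear (p ^ e) τ ∧
      ∀ (y : s.lower) (g : AddMonoidAlgebra k (ι → ℤ)), s.eval g = y →
        (τ y : F) = s.eval (laurentTrace (pow_ne_zero e (Fact.out : p.Prime).ne_zero) f g) := by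
  have hex : ∀ y : s.lower, ∃ g, s.eval g = y := by
    rintro ⟨y, hy⟩
    rw [lower_eq_map] at hy
    obtain ⟨g, -, hg⟩ := hy
    exact ⟨g, hg⟩
  choose G hG using hex
  have hadd : ∀ y z, G (y + z) = G y + G z := fun y z =>
    s.eval_injective (by rw [map_add, hG, hG, hG]; rfl)
  have hmul : ∀ y z, G (y * z) = G y * G z := fun y z =>
    s.eval_injective (by rw [map_mul, hG, hG, hG]; rfl)
  have hpow : ∀ y (n : ℕ), G (y ^ n) = G y ^ n := fun y n =>
    s.eval_injective (by rw [map_pow, hG, hG]; rfl)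
  refine ⟨AddMonoidHom.mk' (fun y => ⟨_, h.laurentTrace_mem hf (g := G y) (hG y ▸ y.2)⟩)
    fun y z => Subtype.ext ?_, fun r y => Subtype.ext ?_, fun y g hg => ?_⟩
  · simp [hadd]
  · have := isPowInvLinear_laurentTrace (ι := ι) hf (G r) (G y)
    simp [hmul, hpow, this, hG]
  · rw [← hG y] at hg
    rw [s.eval_injective hg]
    rfl

/-- A multiplier from the lower bound gives `y` constant coefficient `1`; the trace for `q` larger
than all exponents then sends the product to `1`. -/
theorem IsIsolated.hasPowInvMaps {s : Seed k F ι} (h : s.IsIsolated) :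
    HasPowInvMaps p s.lower := by
  classical
  refine ⟨fun y hy => ?_⟩
  have hyF : (y : F) ≠ 0 := fun h0 => hy (Subtype.ext h0)
  obtain ⟨g, -, hg⟩ : (y : F) ∈ (Algebra.adjoin k (Set.range s.gen)).map s.eval := by
    rw [← lower_eq_map]; exact y.2
  replace hg : s.eval g = y := hg
  set N : ℕ := ∑ a ∈ g.coeff.support, ∑ i, (a i).natAbs with hN
  have hbound : ∀ (g : AddMonoidAlgebra k (ι → ℤ)), ∀ a, g.coeff a ≠ 0 → ∀ i,
      (a i).natAbs ≤ ∑ a ∈ g.coeff.support, ∑ i, (a i).natAbs := fun g a ha i =>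
    (Finset.single_le_sum (f := fun i => (a i).natAbs) (by simp) (Finset.mem_univ i)).trans
      (Finset.single_le_sum (f := fun a : ι → ℤ => ∑ i, (a i).natAbs) (by simp)
        (Finsupp.mem_support_iff.2 ha))
  -- multiply by the partners so that the exponents at mutable vertices become nonpositive
  set m := ∏ i, s.gen (Sum.inr i) ^ N with hm
  have hmL : s.eval m ∈ s.lower := by
    rw [← mem_adjoin_gen_iff]
    exact prod_mem fun i _ => pow_mem (Algebra.subset_adjoin (R := k) (Set.mem_range_self (f := s.gen) (Sum.inr i))) _
  have hm0 : s.eval m ≠ 0 := by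
    rw [hm, map_prod, Finset.prod_ne_zero_iff]
    intro i _
    rw [map_pow]
    refine pow_ne_zero _ ?_
    simp only [gen, Sum.elim_inr, map_mul, eval_laurentMono_single, eval_partnerPoly]
    refine mul_ne_zero ?_ (zpow_ne_zero _ (s.x_ne_zero i))
    split_ifs with hi
    · exact s.exchangePoly_ne_zero hi
    · exact one_ne_zero
  have hm' : m = (∏ i, s.partnerPoly i ^ N) * laurentMono k (fun _ => -(N : ℤ)) := by
    have := s.prod_gen_pow (Sum.elim (fun _ => 0) fun _ => N)
    rw [Fintype.prod_sum_type] at this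
    simpa [hm] using this
  set g' := g * m with hg'
  have hneg : ∀ a, g'.coeff a ≠ 0 → ∀ i, i ∉ s.frozen → a i ≤ 0 := by
    intro a ha i hi
    rw [hg', hm', ← mul_assoc, laurentMono, AddMonoidAlgebra.coeff_mul_single_apply, mul_one] at ha
    have := AddMonoidAlgebra.support_coeff_mul_subset _ _ (Finsupp.mem_support_iff.2 ha)
    obtain ⟨b, hb, c, hc, hbc⟩ := Finset.mem_add.1 this
    have hc' := mem_laurentSupported.1 (prod_mem fun i _ => pow_mem (h.partnerPoly_mem i) N :
      ∏ i, s.partnerPoly i ^ N ∈ laurentSupported k s.frozen) c (Finsupp.mem_support_iff.1 hc) i hi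
    have hb' := hbound g b (Finsupp.mem_support_iff.1 hb) i
    have := congrFun hbc i
    simp only [Pi.add_apply, Pi.neg_apply, neg_neg] at this
    omega
  have hg'0 : g' ≠ 0 := by
    intro h0
    have : s.eval g' = 0 := by rw [h0, map_zero]
    rw [hg', map_mul, hg] at this
    exact mul_ne_zero hyF hm0 this
  obtain ⟨w, hw⟩ : g'.coeff.support.Nonempty := by
    rw [Finsupp.support_nonempty_iff]
    simpa using hg'0
  rw [Finsupp.mem_support_iff] at hw
  set α := g'.coeff w
  -- Normalizes the coefficient at `w` to a constant term `1`. The exponents of `z` are nonnegative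
  -- at mutable vertices, so `z` evaluates into the lower bound.
  set z : AddMonoidAlgebra k (ι → ℤ) := AddMonoidAlgebra.single (-w) α⁻¹ with hz
  have hzL : s.eval z ∈ s.lower := by
    rw [hz, eval_single]
    refine mul_mem (Subalgebra.algebraMap_mem _ _) (prod_mem fun i _ => ?_)
    by_cases hi : i ∈ s.frozen
    · exact zpow_mem_of_mem (x_mem_mixed i) (inv_mem_mixed (by simpa using hi)) _
    · obtain ⟨n, hn⟩ := Int.eq_ofNat_of_zero_le (neg_nonneg.2 (hneg w hw i hi))
      rw [Pi.neg_apply, hn]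
      rw [zpow_natCast]
      exact pow_mem (x_mem_mixed (s := s) i) n
  set M := ∑ a ∈ g'.coeff.support, ∑ i, (a i).natAbs with hM
  set e := 2 * M
  -- Exponents of `z * g'` are differences of two exponents of `g'`, hence at most `2 * M` in
  -- absolute value; a nonzero multiple of `p ^ (e + 1)` cannot occur among them.
  have hlt : 2 * M < p ^ (e + 1) :=
    (Nat.lt_succ_self _).trans (Nat.lt_pow_self (Fact.out : p.Prime).one_lt)
  obtain ⟨f, hf, hf1⟩ := exists_isPowInvLinear (k := k) p (e + 1)
  obtain ⟨τ, hτ, hτe⟩ := h.exists_trace hf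
  refine ⟨e, τ.comp (AddMonoidHom.mulLeft (⟨_, hzL⟩ * ⟨_, hmL⟩)), fun r x => ?_, ?_⟩
  · have : (⟨_, hzL⟩ * ⟨_, hmL⟩ : s.lower) * (r ^ p ^ (e + 1) * x) =
      r ^ p ^ (e + 1) * ((⟨_, hzL⟩ * ⟨_, hmL⟩) * x) := by ring
    simp only [AddMonoidHom.comp_apply, AddMonoidHom.coe_mulLeft, this, hτ _ _]
  · apply Subtype.ext
    rw [AddMonoidHom.comp_apply, AddMonoidHom.coe_mulLeft, hτe _ (z * g') (by
      push_cast [hg', map_mul, hg]; ring)]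
    have : laurentTrace (pow_ne_zero (e + 1) (Fact.out : p.Prime).ne_zero) f (z * g') = 1 := by
      ext b
      rw [coeff_laurentTrace, hz, AddMonoidAlgebra.coeff_single_mul_apply, neg_neg,
        AddMonoidAlgebra.one_def, AddMonoidAlgebra.coeff_single, Finsupp.single_apply]
      split_ifs with hb
      · rw [← hb, smul_zero, add_zero, inv_mul_cancel₀ hw, hf1]
      · by_cases h0 : g'.coeff (w + p ^ (e + 1) • b) = 0
        · rw [h0, mul_zero, map_zero]
        refine absurd ?_ hb
        funext i
        have h1 := hbound g' _ h0 i
        have h2 := hbound g' w hw i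
        rw [← hM] at h1 h2
        rw [Pi.add_apply, Pi.smul_apply, nsmul_eq_mul] at h1
        by_contra hbi
        rw [Pi.zero_apply] at hbi
        have h3 : (p ^ (e + 1)) ≤ ((p ^ (e + 1) : ℕ) * b i : ℤ).natAbs := by
          rw [Int.natAbs_mul, Int.natAbs_natCast]
          exact Nat.le_mul_of_pos_right _ (Int.natAbs_pos.2 fun h => hbi h.symm)
        omega
    rw [this, map_one]
    rfl

end Seed

/-! ### Passage to acyclic seeds and to cluster covers. -/

namespace Seed

variable {k F ι : Type*} [Field k] [Field F] [Algebra k F] [Fintype ι]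

theorem finiteType_lower (s : Seed k F ι) : Algebra.FiniteType k s.lower := by
  classical
  refine Algebra.FiniteType.adjoin_of_finite ?_
  have : {y | ∃ l, y = s.x l ∨
      y = (if l ∈ s.frozenᶜ then s.exchangePoly l else 1) * (s.x l)⁻¹} =
      Set.range s.x ∪ Set.range fun l =>
        (if l ∈ s.frozenᶜ then s.exchangePoly l else 1) * (s.x l)⁻¹ := by
    ext y
    simp only [Set.mem_ofPred_eq, Set.mem_union, Set.mem_range, exists_or, eq_comm]
  convert (Set.finite_range s.x).union (Set.finite_range fun l =>
        (if l ∈ s.frozenᶜ then s.exchangePoly l else 1) * (s.x l)⁻¹) using 1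
  rw [← this]
  ext y
  refine exists_congr fun l => or_congr Iff.rfl ?_
  split_ifs <;> rfl

variable {p : ℕ} [Fact p.Prime] [CharP k p]

theorem isFFinite_lower (hk : IsFFinite p k) (s : Seed k F ι) [CharP s.lower p] :
    IsFFinite p s.lower := by
  have := s.finiteType_lower
  exact IsFFinite.of_finiteType hk

theorem IsAcyclicSeed.hasPowInvMaps (hk : IsFFinite p k) {s : Seed k F ι} (h : s.IsAcyclicSeed) :
    HasPowInvMaps p s.lower := by
  classical
  refine h.induction (motive := fun s => HasPowInvMaps p s.lower)
    (fun s hs => hs.hasPowInvMaps) ?_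
  rintro s i j ⟨a, ha, b, hb, u, hu, hu0, hab⟩ hi hj
  have := charP_subalgebra (p := p) s.lower
  have hxi : s.x i ∈ s.lower := x_mem_mixed i
  have hxj : s.x j ∈ s.lower := x_mem_mixed j
  refine HasPowInvMaps.of_localizations s.lower (isFFinite_lower hk s)
    {⟨s.x i, hxi⟩, ⟨s.x j, hxj⟩} ?_ ?_
  · rw [Ideal.eq_top_iff_one, Finset.coe_pair, Ideal.mem_span_pair]
    refine ⟨⟨a, ha⟩ * ⟨u⁻¹, hu⟩, ⟨b, hb⟩ * ⟨u⁻¹, hu⟩, Subtype.ext ?_⟩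
    push_cast
    field_simp
    rw [hab]; ring
  · intro c hc
    rcases Finset.mem_insert.1 hc with rfl | hc
    · exact ⟨_, s.leLocalization_freeze i, hi⟩
    · obtain rfl := Finset.mem_singleton.1 hc
      exact ⟨_, s.leLocalization_freeze j, hj⟩

variable [DecidableEq ι]

theorem IsAcyclic.exists_eq_lower {s : Seed k F ι} (h : s.IsAcyclic) :
    ∃ t : Seed k F ι, t.IsAcyclicSeed ∧ s.clusterAlgebra = t.lower := by
  obtain ⟨t, hst, ht⟩ := h
  exact ⟨t, ht, by rw [← hst.clusterAlgebra_eq, ht.clusterAlgebra_eq_lower]⟩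

namespace ClusterLocalization

variable {s : Seed k F ι}

open Classical in
/-- The product of the variables that are inverted in a cluster localization. -/
noncomputable def denom (c : s.ClusterLocalization) : F :=
  ∏ i, if i ∈ c.vertices then c.seed.x i else 1

theorem x_mem (c : s.ClusterLocalization) (i : ι) : c.seed.x i ∈ s.clusterAlgebra :=
  Algebra.subset_adjoin (Or.inl ⟨c.seed, c.mutationEquiv, i, rfl⟩)

theorem denom_mem (c : s.ClusterLocalization) : c.denom ∈ s.clusterAlgebra := by
  refine prod_mem fun i _ => ?_
  split_ifs
  · exact c.x_mem i
  · exact one_mem _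

theorem inv_x_mem (c : s.ClusterLocalization) {i : ι} (hi : i ∈ c.vertices) :
    (c.seed.x i)⁻¹ ∈ c.frozenSeed.clusterAlgebra :=
  Algebra.subset_adjoin (Or.inr ⟨i, Or.inr hi, rfl⟩)

theorem inv_denom_mem (c : s.ClusterLocalization) :
    c.denom⁻¹ ∈ c.frozenSeed.clusterAlgebra := by
  rw [denom, ← Finset.prod_inv_distrib]
  refine prod_mem fun i _ => ?_
  split_ifs with hi
  · exact c.inv_x_mem hi
  · simp [one_mem]

theorem denom_ne_zero (c : s.ClusterLocalization) : c.denom ≠ 0 := by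
  refine Finset.prod_ne_zero_iff.2 fun i _ => ?_
  split_ifs
  · exact c.seed.x_ne_zero i
  · exact one_ne_zero

open Classical in
theorem leLocalization (c : s.ClusterLocalization) :
    LeLocalization s.clusterAlgebra c.frozenSeed.clusterAlgebra c.denom where
  le := c.le
  mem := c.denom_mem
  exists_pow_mul_mem y hy := by
    rw [frozenSeed, c.clusterAlgebra_freeze] at hy
    refine exists_pow_mul_mem_of_mem_adjoin c.denom_mem ?_ hy
    rintro z (hz | ⟨i, hi, rfl⟩)
    · exact ⟨0, by simpa using hz⟩
    · refine ⟨1, ?_⟩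
      have : c.denom ^ 1 * (c.seed.x i)⁻¹ =
          ∏ l ∈ Finset.univ.erase i, if l ∈ c.vertices then c.seed.x l else 1 := by
        rw [pow_one, denom, ← Finset.mul_prod_erase _ _ (Finset.mem_univ i), if_pos hi]
        have := c.seed.x_ne_zero i
        field_simp
      rw [this]
      refine prod_mem fun l _ => ?_
      split_ifs
      · exact c.x_mem l
      · exact one_mem _

end ClusterLocalization

/-- A maximal ideal containing all the denominators would be the contraction of a prime from some
member of the cover, where the denominator of that member is a unit. -/
theorem IsClusterCover.span_denom_eq_top {s : Seed k F ι} {C : Set s.ClusterLocalization}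
    (hC : s.IsClusterCover C) : Ideal.span
      {w : s.clusterAlgebra | ∃ c ∈ C, w = ⟨c.denom, c.denom_mem⟩} = ⊤ := by
  by_contra hne
  obtain ⟨m, hm, hle⟩ := Ideal.exists_le_maximal _ hne
  have hmem : (⟨m, hm.isPrime⟩ : PrimeSpectrum s.clusterAlgebra) ∈
      ⋃ c ∈ C, Set.range c.specMap := by
    rw [show (⋃ c ∈ C, Set.range c.specMap) = Set.univ from hC]; trivial
  simp only [Set.mem_iUnion, Set.mem_range] at hmem
  obtain ⟨c, hc, Q, hQ⟩ := hmem
  have h1 : (⟨c.denom, c.denom_mem⟩ : s.clusterAlgebra) ∈ m :=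
    hle (Ideal.subset_span ⟨c, hc, rfl⟩)
  have h2 : Subalgebra.inclusion c.le ⟨c.denom, c.denom_mem⟩ ∈ Q.asIdeal := by
    have h3 : (c.specMap Q).asIdeal =
      Ideal.comap (Subalgebra.inclusion c.le).toRingHom Q.asIdeal := rfl
    have h4 : (c.specMap Q).asIdeal = m := by rw [hQ]
    rw [← h4, h3, Ideal.mem_comap] at h1
    exact h1
  refine Q.isPrime.ne_top (Ideal.eq_top_of_isUnit_mem _ h2 ?_)
  refine IsUnit.of_mul_eq_one ⟨c.denom⁻¹, c.inv_denom_mem⟩ (Subtype.ext ?_)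
  rw [MulMemClass.coe_mul, Subalgebra.coe_inclusion, OneMemClass.coe_one]
  exact mul_inv_cancel₀ c.denom_ne_zero

end Seed

end ClusterAlg

theorem mainTheorem1 {p : ℕ} [Fact p.Prime] {k F ι : Type*} [Field k] [CharP k p]
    (hk : ClusterAlg.IsFFinite p k) [Field F] [Algebra k F] [Fintype ι] [DecidableEq ι]
    (s : ClusterAlg.Seed k F ι) (hs : s.IsLocallyAcyclic) :
    ClusterAlg.IsStronglyFRegular p s.clusterAlgebra := by
  obtain ⟨C, hC, hacyclic⟩ := hs
  -- Quasi-compactness: the cover may be infinite, but finitely many denominators already generate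
  -- the unit ideal.
  obtain ⟨T, hTC, hT⟩ := (Ideal.span_eq_top_iff_finite _).1 hC.span_denom_eq_top
  have key : ∀ w ∈ T, ∃ B : Subalgebra k F, ClusterAlg.LeLocalization s.clusterAlgebra B w ∧
      ClusterAlg.HasPowInvMaps p B ∧ ∀ _ : CharP B p, ClusterAlg.IsFFinite p B := by
    intro w hw
    obtain ⟨c, hc, rfl⟩ := hTC hw
    obtain ⟨t, ht, heq⟩ := (hacyclic c hc).exists_eq_lower
    refine ⟨t.lower, ?_, ht.hasPowInvMaps hk, fun _ => t.isFFinite_lower hk⟩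
    rw [← heq]
    exact c.leLocalization
  -- Finite generation of the cluster algebra over `k` is not assumed, so its `F`-finiteness is
  -- glued from the cover; it is needed before the inverse linear maps can be glued.
  have hF : ClusterAlg.IsFFinite p s.clusterAlgebra :=
    ClusterAlg.IsFFinite.of_localizations _ T hT fun w hw => by
      obtain ⟨B, hB, -, hBF⟩ := key w hw
      have := ClusterAlg.charP_subalgebra (p := p) B
      exact ⟨B, this, hB, hBF this⟩
  refine (ClusterAlg.HasPowInvMaps.of_localizations _ hF T hT fun w hw => ?_).isStronglyFRegular hF
  obtain ⟨B, hB, hBm, -⟩ := key w hw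
  exact ⟨B, hB, hBm⟩
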